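/- Let $\mathbb{C}\langle x_1,\dots,x_d\rangle$ be the $*$-algebra of polynomials in $d$ non-commuting self-adjoint variables. A functional on it is a linear, unital, $*$-compatible map to $\mathbb{C}$; a state is a functional $\phi$ with $\phi[P^*P]\ge 0$ for all $P$. For a functional $\phi$ let $M^\phi(\mathbf w)=\sum_{|\vec u|\ge 1}\phi[x_{\vec u}]w_{\vec u}$ be its moment series (in non-commuting indeterminates), $\eta^\phi=1-(1+M^\phi)^{-1}$ its Boolean cumulant series, and $R^\phi$ its free cumulant series, the solution of $M^\phi(\mathbf w)=R^\phi((1+M^\phi(\mathbf w))\mathbf w)$, where $(1+M^\phi(\mathbf w))\mathbf w$ is the tuple with entries $(1+M^\phi(\mathbf w))w_i$. Functionals $\phi\boxplus\psi$, $\phi^{\boxplus t}$, $\phi\uplus\psi$, $\phi^{\uplus t}$ ($t\in\mathbb{R}$) are defined by $R^{\phi\boxplus\psi}=R^\phi+R^\psi$, $R^{\phi^{\boxplus t}}=tR^\phi$, $\eta^{\phi\uplus\psi}=\eta^\phi+\eta^\psi$, $\eta^{\phi^{\uplus t}}=t\eta^\phi$. A functional $\rho$ is a freely infinitely divisible state if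 $\rho^{\boxplus t}$ is a state for every $t\ge 0$. For $\mathbf a\in\mathbb{R}^d$ put $\delta_{\mathbf a}[P]=P(a_1,\dots,a_d)$ and, for $t\neq -1$, $$\mathbb{B}_{\mathbf a,t}[\rho]=\bigl((\rho^{\boxplus(1+t)}\boxplus\delta_{\mathbf a})\uplus\delta_{-\mathbf a}\bigr)^{\uplus 1/(1+t)},\qquad \mathbb{B}=\mathbb{B}_{0,1}.$$ For functionals $\rho,\psi$ define functionals $\Phi[\rho,\psi]$ and $\Phi[\psi]$ by $$\eta^{\Phi[\rho,\psi]}(\mathbf w)=(1+M^\psi(\mathbf w))^{-1}R^\rho\bigl((1+M^\psi(\mathbf w))\mathbf w\bigr),\qquad \eta^{\Phi[\psi]}(\mathbf w)=\sum_{i=1}^d w_i(1+M^\psi(\mathbf w))w_i .$$ In one variable, let $\mu_{b,0}$ ($b\in\mathbb{R}$) be the functional with Jacobi parameters $(0,b,b,\dots)$, $(1,1,1,\dots)$; thus $\mu_{0,0}$ is the standard semicircular distribution and the $\mu_{b,0}$ are the centered free Poisson distributions of variance one. (a) For functionals with $\phi=\Phi[\rho,\psi]$, any two of $\phi,\rho,\psi$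 determine the third uniquely; for $\psi$ to be determined by $\phi$ and $\rho$ it is assumed that $\rho$ is not of the form $\delta_{\mathbf a}$. (b) If $\rho$ is a freely infinitely divisible state and $\psi$ is a state, then $\Phi[\rho,\psi]$ is a state. Moreover, $\Phi[\rho,\psi]$ has the same mean and covariance as $\rho$. (c) For functionals, $\Phi[\rho,\psi]=\psi$ if and only if $\psi=\rho$; and $\Phi[\sigma,\rho]=\sigma$ if and only if $\sigma=\rho$ or $\sigma=\delta_{\mathbf a}$ for some $\mathbf a$ (so $\rho$ is the unique fixed point of $\Phi[\rho,\cdot]$ and, apart from the $\delta_{\mathbf a}$, the only fixed point of $\Phi[\cdot,\rho]$). In particular, the free product of $d$ standard semicircular distributions is the unique fixed point of $\psi\mapsto\Phi[\psi]$. (d) In one variable, let $\rho$ be a freely infinitely divisible state with mean zero and variance one. Then $\{\Phi[\rho,\psi]:\psi\text{ a state}\}$ is the set of all states with the same mean and covariance as $\rho$ if and only if $\rho=\mu_{b,0}$ for some $b\in\mathbb{R}$. All the $\mu_{b,0}$ are freely infinitely divisible states with mean zero and variance one, $\Phi[\mu_{0,0},\psi]=\Phi[\psi]$ and $\Phi[\mu_{b,0},\psi]=\Phi[\psi\uplus\delta_b]$.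 In $d\ge 2$ variables, for a freely infinitely divisible state $\rho$ with mean zero and identity covariance, $\{\Phi[\rho,\psi]:\psi\text{ a state}\}$ is never the set of all states with the same mean and covariance as $\rho$. (e) For a state $\psi$, the map $\Phi[\cdot,\psi]$ from freely infinitely divisible states to states is onto if and only if $\psi=\delta_{\mathbf a}$ for some $\mathbf a\in\mathbb{R}^d$. The map $\mathbb{B}$ is a bijection of the set of functionals, and for every functional $\rho$ and every $\mathbf a$, $\Phi[\rho,\delta_0]=\mathbb{B}^{-1}[\rho]$ and $$\Phi[\rho,\delta_{\mathbf a}]=\mathbb{B}_{\mathbf a,0}\bigl[\mathbb{B}^{-1}[\rho]\bigr]=\lim_{t\to -1}\mathbb{B}_{\mathbf a,t}[\rho],$$ the limit being taken at each polynomial. -/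

import Mathlib

open Finset
open scoped ComplexConjugate

/-! ### Formal power series in non-commuting variables -/

/-- Formal power series with complex coefficients in the non-commuting variables
`z 0, ..., z (d - 1)`; `F u` is the coefficient of the monomial `z_{u(1)} ... z_{u(n)}`. -/
def NCSeries (d : ℕ) : Type := List (Fin d) → ℂ

namespace NCSeries

variable {d : ℕ}

noncomputable instance : AddCommGroup (NCSeries d) :=
  inferInstanceAs (AddCommGroup (List (Fin d) → ℂ))

noncomputable instance : Module ℂ (NCSeries d) :=
  inferInstanceAs (Module ℂ (List (Fin d) → ℂ))

@[ext] theorem ext {F G : NCSeries d} (h : ∀ u, F u = G u) : F = G := funext h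

theorem zero_apply (u : List (Fin d)) : (0 : NCSeries d) u = 0 := rfl
theorem add_apply (F G : NCSeries d) (u) : (F + G) u = F u + G u := rfl
theorem sub_apply (F G : NCSeries d) (u) : (F - G) u = F u - G u := rfl
theorem neg_apply (F : NCSeries d) (u) : (-F) u = -F u := rfl
theorem smul_apply (c : ℂ) (F : NCSeries d) (u) : (c • F) u = c * F u := rfl

noncomputable instance : One (NCSeries d) := ⟨fun u => if u = [] then 1 else 0⟩

/-- The Cauchy product: a word is cut in two in all possible ways. -/
noncomputable instance : Mul (NCSeries d) :=
  ⟨fun F G u => ∑ k ∈ range (u.length + 1), F (u.take k) * G (u.drop k)⟩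

theorem one_apply (u : List (Fin d)) : (1 : NCSeries d) u = if u = [] then 1 else 0 := rfl

theorem mul_apply (F G : NCSeries d) (u : List (Fin d)) :
    (F * G) u = ∑ k ∈ range (u.length + 1), F (u.take k) * G (u.drop k) := rfl

theorem mul_nil (F G : NCSeries d) : (F * G) [] = F [] * G [] := by
  simp [mul_apply]

/-- The left derivative `D_i`. -/
def leftD (i : Fin d) (F : NCSeries d) : NCSeries d := fun u => F (i :: u)

theorem mul_cons (F G : NCSeries d) (i : Fin d) (u : List (Fin d)) :
    (F * G) (i :: u) = (leftD i F * G) u + F [] * G (i :: u) := by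
  simp only [mul_apply, List.length_cons]
  rw [sum_range_succ']
  simp [leftD]

protected theorem mul_add' (F G H : NCSeries d) : F * (G + H) = F * G + F * H := by
  ext u; simp only [mul_apply, add_apply, mul_add, sum_add_distrib]

protected theorem add_mul' (F G H : NCSeries d) : (F + G) * H = F * H + G * H := by
  ext u; simp only [mul_apply, add_apply, add_mul, sum_add_distrib]

protected theorem smul_mul' (c : ℂ) (F G : NCSeries d) : (c • F) * G = c • (F * G) := by
  ext u; simp only [mul_apply, smul_apply, mul_sum, mul_assoc]

protected theorem mul_smul' (c : ℂ) (F G : NCSeries d) : F * (c • G) = c • (F * G) := by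
  ext u; simp only [mul_apply, smul_apply, mul_sum, mul_left_comm]

protected theorem mul_assoc' (F G H : NCSeries d) : F * G * H = F * (G * H) := by
  ext u
  induction u generalizing F G with
  | nil => simp only [mul_nil, mul_assoc]
  | cons i u ih =>
    have e : leftD i (F * G) = leftD i F * G + F [] • leftD i G := by
      ext v; simp only [leftD, mul_cons, add_apply, smul_apply]
    rw [mul_cons, mul_cons, e, NCSeries.add_mul', NCSeries.smul_mul', add_apply, smul_apply, ih,
      mul_cons, mul_nil]
    ring

protected theorem one_mul' (F : NCSeries d) : 1 * F = F := by
  ext u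
  cases u with
  | nil => simp [mul_nil, one_apply]
  | cons i u =>
    have e : leftD i (1 : NCSeries d) = 0 := by ext v; simp [leftD, one_apply, zero_apply]
    rw [mul_cons, e]
    simp [mul_apply, zero_apply, one_apply]

protected theorem mul_one' (F : NCSeries d) : F * 1 = F := by
  ext u
  induction u generalizing F with
  | nil => simp [mul_nil, one_apply]
  | cons i u ih =>
    rw [mul_cons, ih]
    simp [leftD, one_apply]

noncomputable instance : Ring (NCSeries d) :=
  { (inferInstance : AddCommGroup (NCSeries d)) with
    mul := (· * ·)
    one := 1
    mul_assoc := NCSeries.mul_assoc'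
    one_mul := NCSeries.one_mul'
    mul_one := NCSeries.mul_one'
    left_distrib := NCSeries.mul_add'
    right_distrib := NCSeries.add_mul'
    zero_mul := fun F => by ext u; simp [mul_apply, zero_apply]
    mul_zero := fun F => by ext u; simp [mul_apply, zero_apply] }

/-- The variable `z i`. -/
noncomputable def X (i : Fin d) : NCSeries d := fun u => if u = [i] then 1 else 0

theorem sum_apply {ι : Type*} (s : Finset ι) (f : ι → NCSeries d) (u : List (Fin d)) :
    (∑ i ∈ s, f i) u = ∑ i ∈ s, f i u :=
  map_sum (⟨⟨fun F : NCSeries d => F u, rfl⟩, fun _ _ => rfl⟩ : NCSeries d →+ ℂ) f s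

/-- The inverse of a series with constant term `1`, as the geometric series in `1 - F`. -/
noncomputable def inv (F : NCSeries d) : NCSeries d :=
  fun u => ∑ k ∈ range (u.length + 1), ((1 - F) ^ k) u

/-- The composition `F(H_1, ..., H_d)` with series `H_i` without constant term: every variable
`z i` of `F` is replaced by `H i`. -/
noncomputable def comp (F : NCSeries d) (H : Fin d → NCSeries d) : NCSeries d :=
  fun u => ∑ k ∈ range (u.length + 1), ∑ v : Fin k → Fin d,
    F (List.ofFn v) * (List.ofFn fun j => H (v j)).prod u

/-- Two series agree on the monomials of degree less than `n`. -/
def AgreeTo (n : ℕ) (F G : NCSeries d) : Prop := ∀ u : List (Fin d), u.length < n → F u = G u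

theorem eq_of_agreeTo {F G : NCSeries d} (h : ∀ n, AgreeTo n F G) : F = G := by
  ext u; exact h (u.length + 1) u (Nat.lt_succ_self _)

theorem AgreeTo.mul {n : ℕ} {F F' G G' : NCSeries d} (hF : AgreeTo n F F') (hG : AgreeTo n G G') :
    AgreeTo n (F * G) (F' * G') := by
  intro u hu
  simp only [mul_apply]
  refine sum_congr rfl fun k _ => ?_
  rw [hF _ (by simp; omega), hG _ (by simp; omega)]

theorem AgreeTo.mul_X {n : ℕ} {F G : NCSeries d} (h : AgreeTo n F G) (i : Fin d) :
    AgreeTo (n + 1) (F * X i) (G * X i) := by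
  intro u hu
  simp only [mul_apply]
  refine sum_congr rfl fun k hk => ?_
  simp only [mem_range] at hk
  by_cases hku : k = u.length
  · subst hku; simp [X]
  · rw [h _ (by simp; omega)]

theorem AgreeTo.list_prod {n : ℕ} {L L' : List (NCSeries d)}
    (h : List.Forall₂ (AgreeTo n) L L') : AgreeTo n L.prod L'.prod := by
  induction h with
  | nil => intro u _; rfl
  | cons h _ ih => simpa using h.mul ih

theorem list_prod_apply_eq_zero (L : List (NCSeries d)) (hL : ∀ F ∈ L, F [] = 0)
    (u : List (Fin d)) (hu : u.length < L.length) : L.prod u = 0 := by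
  induction L generalizing u with
  | nil => simp at hu
  | cons F L ih =>
    rw [List.prod_cons, mul_apply]
    refine sum_eq_zero fun k _ => ?_
    by_cases hk : k = 0
    · subst hk; simp [hL F (by simp)]
    · by_cases hun : u = []
      · subst hun; simp [hL F (by simp)]
      · rw [ih (fun G hG => hL G (by simp [hG])) (u.drop k), mul_zero]
        have := List.length_pos_of_ne_nil hun
        simp at hu ⊢
        omega

theorem agreeTo_inv (F : NCSeries d) (hF : F [] = 1) (n : ℕ) :
    AgreeTo n (inv F) (∑ k ∈ range n, (1 - F) ^ k) := by
  intro u hu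
  rw [sum_apply]
  refine sum_subset (fun k hk => by simp at hk ⊢; omega) fun k _ hk => ?_
  rw [← List.prod_replicate]
  refine list_prod_apply_eq_zero _ (fun G hG => ?_) _ (by simp at hk ⊢; omega)
  rw [List.eq_of_mem_replicate hG, sub_apply, hF]; simp [one_apply]

theorem agreeTo_geom (F : NCSeries d) (hF : F [] = 1) (n : ℕ) : AgreeTo n (1 - (1 - F) ^ n) 1 := by
  intro u hu
  rw [sub_apply, ← List.prod_replicate, list_prod_apply_eq_zero _ (fun G hG => ?_) _ (by simpa),
    sub_zero]
  rw [List.eq_of_mem_replicate hG, sub_apply, hF]; simp [one_apply]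

theorem mul_inv (F : NCSeries d) (hF : F [] = 1) : F * inv F = 1 := by
  refine eq_of_agreeTo fun n u hu => ?_
  rw [(AgreeTo.mul (fun _ _ => rfl : AgreeTo n F F) (agreeTo_inv F hF n)) u hu,
    ← agreeTo_geom F hF n u hu, ← mul_neg_geom_sum (1 - F) n, sub_sub_cancel]

theorem inv_mul (F : NCSeries d) (hF : F [] = 1) : inv F * F = 1 := by
  refine eq_of_agreeTo fun n u hu => ?_
  rw [(AgreeTo.mul (agreeTo_inv F hF n) (fun _ _ => rfl : AgreeTo n F F)) u hu,
    ← agreeTo_geom F hF n u hu, ← geom_sum_mul_neg (1 - F) n, sub_sub_cancel]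

theorem inv_nil (F : NCSeries d) : inv F [] = 1 := by simp [inv, one_apply]

/-- The sum of the terms of degree less than `n` of the outer series in a composition. -/
noncomputable def compTrunc (n : ℕ) (F : NCSeries d) (H : Fin d → NCSeries d) : NCSeries d :=
  ∑ k ∈ range n, ∑ v : Fin k → Fin d, F (List.ofFn v) • (List.ofFn fun j => H (v j)).prod

theorem agreeTo_comp (F : NCSeries d) (H : Fin d → NCSeries d) (hH : ∀ i, H i [] = 0) (n : ℕ) :
    AgreeTo n (comp F H) (compTrunc n F H) := by
  intro u hu
  simp only [compTrunc, comp, sum_apply, smul_apply]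
  refine sum_subset (fun k hk => by simp at hk ⊢; omega) fun k _ hk => ?_
  refine sum_eq_zero fun v _ => ?_
  rw [list_prod_apply_eq_zero, mul_zero]
  · intro G hG
    obtain ⟨j, rfl⟩ := (List.mem_ofFn' _ _).1 hG
    exact hH _
  · simp at hk ⊢; omega

theorem comp_nil (F : NCSeries d) (H : Fin d → NCSeries d) : comp F H [] = F [] := by
  simp [comp, one_apply]

theorem comp_agreeTo {n : ℕ} (F : NCSeries d) {H H' : Fin d → NCSeries d}
    (h : ∀ i, AgreeTo n (H i) (H' i)) : AgreeTo n (comp F H) (comp F H') := by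
  intro u hu
  refine sum_congr rfl fun k _ => sum_congr rfl fun v _ => ?_
  rw [AgreeTo.list_prod (n := n) _ u hu]
  rw [List.forall₂_iff_get]
  simp [h]

/-- The `d`-tuple of series `(G w_1, ..., G w_d)`. -/
noncomputable def leftDilate (G : NCSeries d) : Fin d → NCSeries d := fun i => G * X i

theorem leftDilate_nil (G : NCSeries d) (i : Fin d) : leftDilate G i [] = 0 := by
  simp [leftDilate, mul_nil, X]

/-! ### Fixed points of contractions for the degree filtration -/

/-- The value of `T F` up to degree `n` depends only on `F` up to degree `n - 1`. -/
def Contracting (T : NCSeries d → NCSeries d) : Prop :=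
  ∀ n F G, AgreeTo n F G → AgreeTo (n + 1) (T F) (T G)

/-- The coefficientwise limit of the iterates `T (T (... (T 0)))`. -/
noncomputable def fix (T : NCSeries d → NCSeries d) : NCSeries d :=
  fun u => (T^[u.length + 1] 0) u

theorem Contracting.iterate {T : NCSeries d → NCSeries d} (hT : Contracting T) (F G : NCSeries d)
    (n : ℕ) : AgreeTo n (T^[n] F) (T^[n] G) := by
  induction n with
  | zero => intro u hu; simp at hu
  | succ n ih => rw [Function.iterate_succ_apply', Function.iterate_succ_apply']; exact hT _ _ _ ih

theorem Contracting.agreeTo_fix {T : NCSeries d → NCSeries d} (hT : Contracting T) (n : ℕ) :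
    AgreeTo n (fix T) (T^[n] 0) := by
  intro u hu
  obtain ⟨m, rfl⟩ := Nat.exists_eq_add_of_lt hu
  rw [show u.length + m + 1 = (u.length + 1) + m by omega, Function.iterate_add_apply T _ m 0]
  exact hT.iterate _ _ (u.length + 1) u (Nat.lt_succ_self _)

theorem Contracting.fix_eq {T : NCSeries d → NCSeries d} (hT : Contracting T) :
    T (fix T) = fix T := by
  refine eq_of_agreeTo fun n u hu => ?_
  rw [hT n _ _ (hT.agreeTo_fix n) u (by omega), hT.agreeTo_fix (n + 1) u (by omega),
    Function.iterate_succ_apply' T]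

theorem Contracting.unique {T : NCSeries d → NCSeries d} (hT : Contracting T) {F G : NCSeries d}
    (hF : T F = F) (hG : T G = G) : F = G := by
  refine eq_of_agreeTo fun n => ?_
  induction n with
  | zero => intro u hu; simp at hu
  | succ n ih => rw [← hF, ← hG]; exact hT _ _ _ ih

/-! ### Cumulant series -/

/-- The Boolean cumulant series `1 - (1 + M)⁻¹`. -/
noncomputable def etaOf (M : NCSeries d) : NCSeries d := 1 - inv (1 + M)

/-- The moment series `(1 - η)⁻¹ - 1` with Boolean cumulant series `η`. -/
noncomputable def momentOfEta (E : NCSeries d) : NCSeries d := inv (1 - E) - 1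

/-- The free cumulant series `R` of a moment series `M`, the solution of
`R((1 + M(w)) w) = M(w)`. -/
noncomputable def freeOf (M : NCSeries d) : NCSeries d :=
  fix fun R => R + (M - comp R (leftDilate (1 + M)))

/-- The moment series `M` with free cumulant series `R`, the solution of
`M(w) = R((1 + M(w)) w)`. -/
noncomputable def momentOfFree (R : NCSeries d) : NCSeries d :=
  fix fun M => comp R (leftDilate (1 + M))

theorem list_prod_leftDilate (G : NCSeries d) (hG : G [] = 1) (l u : List (Fin d))
    (h : u.length = l.length) : (l.map (leftDilate G)).prod u = if u = l then 1 else 0 := by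
  induction l generalizing u with
  | nil => simp at h; simp [h, one_apply]
  | cons i l ih =>
    obtain ⟨j, v, rfl⟩ := List.exists_cons_of_length_pos (l := u) (by simp [h])
    simp only [List.length_cons, Nat.add_right_cancel_iff] at h
    rw [List.map_cons, List.prod_cons, mul_cons, leftDilate_nil, zero_mul, add_zero, mul_apply,
      sum_range_succ', sum_eq_zero]
    · have : (leftD j (leftDilate G i)) [] = if j = i then 1 else 0 := by
        simp [leftD, leftDilate, mul_cons, mul_nil, X, hG]
      simp only [List.take_zero, List.drop_zero, zero_add, this, ih v h]
      by_cases hj : j = i <;> by_cases hv : v = l <;> simp [hj, hv]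
    · intro k hk
      rw [list_prod_apply_eq_zero, mul_zero]
      · intro F hF
        obtain ⟨i, _, rfl⟩ := List.mem_map.1 hF
        exact leftDilate_nil G i
      · simp at hk ⊢; omega

theorem comp_leftDilate_apply (F G : NCSeries d) (hG : G [] = 1) (u : List (Fin d)) :
    comp F (leftDilate G) u = (∑ k ∈ range u.length, ∑ v : Fin k → Fin d,
      F (List.ofFn v) * (List.ofFn fun j => leftDilate G (v j)).prod u) + F u := by
  rw [comp, sum_range_succ]
  congr 1
  have : ∀ v : Fin u.length → Fin d, F (List.ofFn v) *
      (List.ofFn fun j => leftDilate G (v j)).prod u = if v = u.get then F u else 0 := by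
    intro v
    have e : (List.ofFn fun j => leftDilate G (v j)) = (List.ofFn v).map (leftDilate G) := by
      rw [List.map_ofFn]; rfl
    rw [e, list_prod_leftDilate G hG _ _ (by simp)]
    by_cases h : v = u.get
    · subst h; simp
    · rw [if_neg h, if_neg, mul_zero]
      intro h'
      apply h
      apply List.ofFn_injective
      rw [← h', List.ofFn_get]
  simp [this]

theorem contracting_freeOf (M : NCSeries d) (hM : M [] = 0) :
    Contracting fun R : NCSeries d => R + (M - comp R (leftDilate (1 + M))) := by
  intro n F G h u hu
  have h1 : (1 + M) [] = 1 := by simp [add_apply, one_apply, hM]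
  simp only [add_apply, sub_apply, comp_leftDilate_apply _ _ h1]
  have : ∀ k ∈ range u.length, ∀ v : Fin k → Fin d, F (List.ofFn v) = G (List.ofFn v) := by
    intro k hk v
    apply h
    simp at hk ⊢; omega
  rw [sum_congr rfl fun k hk => sum_congr rfl fun v _ => by rw [this k hk v]]
  ring

theorem contracting_momentOfFree (R : NCSeries d) :
    Contracting fun M : NCSeries d => comp R (leftDilate (1 + M)) := by
  intro n F G h
  refine comp_agreeTo R fun i => AgreeTo.mul_X (fun u hu => ?_) i
  rw [add_apply, add_apply, h u hu]

theorem freeOf_spec (M : NCSeries d) (hM : M [] = 0) :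
    comp (freeOf M) (leftDilate (1 + M)) = M := by
  have := (contracting_freeOf M hM).fix_eq
  exact (sub_eq_zero.1 (left_eq_add.1 this.symm)).symm

theorem freeOf_unique (M R : NCSeries d) (hM : M [] = 0)
    (h : comp R (leftDilate (1 + M)) = M) : R = freeOf M :=
  (contracting_freeOf M hM).unique (by simp [h]) (contracting_freeOf M hM).fix_eq

theorem momentOfFree_spec (R : NCSeries d) :
    comp R (leftDilate (1 + momentOfFree R)) = momentOfFree R :=
  (contracting_momentOfFree R).fix_eq

theorem momentOfFree_unique (M R : NCSeries d) (h : comp R (leftDilate (1 + M)) = M) :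
    M = momentOfFree R :=
  (contracting_momentOfFree R).unique h (contracting_momentOfFree R).fix_eq

theorem momentOfFree_nil (R : NCSeries d) (hR : R [] = 0) : momentOfFree R [] = 0 := by
  rw [← momentOfFree_spec, comp_nil, hR]

theorem freeOf_nil (M : NCSeries d) (hM : M [] = 0) : freeOf M [] = 0 := by
  have := congrFun (freeOf_spec M hM) []
  rwa [comp_nil, hM] at this

theorem etaOf_nil (M : NCSeries d) : etaOf M [] = 0 := by
  simp [etaOf, sub_apply, inv_nil, one_apply]

theorem inv_eq_of_mul_eq_one {F G : NCSeries d} (hF : F [] = 1) (h : F * G = 1) : inv F = G := by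
  rw [← mul_one (inv F), ← h, ← mul_assoc, inv_mul F hF, one_mul]

theorem etaOf_momentOfEta (E : NCSeries d) (hE : E [] = 0) : etaOf (momentOfEta E) = E := by
  have h1 : (1 - E) [] = 1 := by simp [sub_apply, one_apply, hE]
  rw [etaOf, momentOfEta, add_sub_cancel, inv_eq_of_mul_eq_one (inv_nil _) (inv_mul _ h1),
    sub_sub_cancel]

theorem momentOfEta_etaOf (M : NCSeries d) (hM : M [] = 0) : momentOfEta (etaOf M) = M := by
  have h1 : (1 + M) [] = 1 := by simp [add_apply, one_apply, hM]
  rw [etaOf, momentOfEta, sub_sub_cancel, inv_eq_of_mul_eq_one (inv_nil _) (inv_mul _ h1),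
    add_sub_cancel_left]

/-! ### Self-adjoint series -/

/-- The adjoint series: coefficients are conjugated and monomials reversed. -/
noncomputable def adj (F : NCSeries d) : NCSeries d := fun u => conj (F u.reverse)

theorem adj_apply (F : NCSeries d) (u) : adj F u = conj (F u.reverse) := rfl

theorem adj_adj (F : NCSeries d) : adj (adj F) = F := by ext u; simp [adj]

theorem adj_one : adj (1 : NCSeries d) = 1 := by
  ext u; by_cases h : u = [] <;> simp [adj, one_apply, h]

theorem adj_X (i : Fin d) : adj (X i) = X i := by
  ext u
  have : u.reverse = [i] ↔ u = [i] := by rw [List.reverse_eq_iff]; rfl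
  by_cases h : u = [i] <;> simp [adj, X, this, h]

theorem adj_add (F G : NCSeries d) : adj (F + G) = adj F + adj G := by
  ext u; simp [adj, add_apply]

theorem adj_sub (F G : NCSeries d) : adj (F - G) = adj F - adj G := by
  ext u; simp [adj, sub_apply]

theorem adj_smul (c : ℂ) (F : NCSeries d) : adj (c • F) = conj c • adj F := by
  ext u; simp [adj, smul_apply]

theorem adj_sum {ι : Type*} (s : Finset ι) (f : ι → NCSeries d) :
    adj (∑ i ∈ s, f i) = ∑ i ∈ s, adj (f i) := by
  ext u; simp [adj, sum_apply]

theorem adj_mul (F G : NCSeries d) : adj (F * G) = adj G * adj F := by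
  ext u
  simp only [adj_apply, mul_apply, map_sum, map_mul, List.length_reverse]
  rw [← sum_range_reflect]
  refine sum_congr rfl fun k hk => ?_
  simp only [mem_range] at hk
  rw [mul_comm, List.reverse_take, List.reverse_drop,
    show u.length + 1 - 1 - k = u.length - k by omega]

theorem adj_list_prod (L : List (NCSeries d)) : adj L.prod = (L.map adj).reverse.prod := by
  induction L with
  | nil => simp [adj_one]
  | cons F L ih => simp [adj_mul, ih]

theorem AgreeTo.adj {n : ℕ} {F G : NCSeries d} (h : AgreeTo n F G) :
    AgreeTo n (adj F) (adj G) := by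
  intro u hu; rw [adj_apply, adj_apply, h _ (by simpa)]

theorem adj_comp (F : NCSeries d) (H : Fin d → NCSeries d) :
    adj (comp F H) = comp (adj F) fun i => adj (H i) := by
  ext u
  simp only [adj_apply, comp, map_sum, map_mul, List.length_reverse]
  refine sum_congr rfl fun k _ => ?_
  refine Fintype.sum_equiv (Fin.revPerm.arrowCongr (Equiv.refl _)) _ _ fun v => ?_
  have e1 : ∀ {α : Type} (w : Fin k → α), (List.ofFn fun j => w (Fin.rev j)) =
      (List.ofFn w).reverse := by
    intro α w
    apply List.ext_getElem <;> simp
    intro j hj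
    congr 1
    ext
    simp
    omega
  have e2 : (Fin.revPerm.arrowCongr (Equiv.refl (Fin d))) v = fun j => v (Fin.rev j) := by
    ext j; simp [Equiv.arrowCongr]
  rw [e2, e1 v, e1 fun j => NCSeries.adj (H (v j)), List.reverse_reverse]
  congr 1
  rw [← adj_apply, adj_list_prod, List.map_ofFn]
  rfl

theorem adj_inv (F : NCSeries d) (hF : F [] = 1) : adj (inv F) = inv (adj F) := by
  refine (inv_eq_of_mul_eq_one (by simp [adj, hF]) ?_).symm
  rw [← adj_mul, inv_mul F hF, adj_one]

theorem comp_leftDilate_mul (F G : NCSeries d) :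
    comp F (leftDilate G) * G = G * comp F fun i => X i * G := by
  have key : ∀ l : List (Fin d), (l.map (leftDilate G)).prod * G =
      G * (l.map fun i => X i * G).prod := by
    intro l
    induction l with
    | nil => simp
    | cons i l ih =>
      rw [List.map_cons, List.prod_cons, mul_assoc, ih, List.map_cons, List.prod_cons, leftDilate]
      simp only [mul_assoc]
  refine eq_of_agreeTo fun n u hu => ?_
  rw [AgreeTo.mul (agreeTo_comp F _ (leftDilate_nil G) n) (fun _ _ => rfl : AgreeTo n G G) u hu,
    AgreeTo.mul (fun _ _ => rfl : AgreeTo n G G)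
      (agreeTo_comp F (fun i => X i * G) (fun i => by simp [mul_nil, X]) n) u hu]
  refine congrFun (?_ : _ = _) u
  simp only [compTrunc, sum_mul, mul_sum]
  refine Finset.sum_congr rfl fun k _ => Finset.sum_congr rfl fun v _ => ?_
  rw [NCSeries.smul_mul', NCSeries.mul_smul']
  congr 1
  have := key (List.ofFn v)
  simpa only [List.map_ofFn, Function.comp_def] using this

theorem adj_leftDilate (G : NCSeries d) (i : Fin d) : adj (leftDilate G i) = X i * adj G := by
  rw [leftDilate, adj_mul, adj_X]

/-- The series `(1 + M(w))⁻¹ R((1 + M(w)) w)`. -/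
noncomputable def condSeries (R M : NCSeries d) : NCSeries d :=
  inv (1 + M) * comp R (leftDilate (1 + M))

theorem condSeries_nil (R M : NCSeries d) (hR : R [] = 0) : condSeries R M [] = 0 := by
  rw [condSeries, mul_nil, comp_nil, hR, mul_zero]

theorem adj_condSeries (R M : NCSeries d) (hM : M [] = 0) (hRa : adj R = R) (hMa : adj M = M) :
    adj (condSeries R M) = condSeries R M := by
  have h1 : (1 + M) [] = 1 := by simp [add_apply, one_apply, hM]
  have ha : adj (1 + M) = 1 + M := by rw [adj_add, adj_one, hMa]
  rw [condSeries, adj_mul, adj_inv _ h1, ha, adj_comp, hRa]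
  simp only [adj_leftDilate, ha]
  calc comp R (fun i => X i * (1 + M)) * inv (1 + M)
      = inv (1 + M) * ((1 + M) * comp R fun i => X i * (1 + M)) * inv (1 + M) := by
        rw [← mul_assoc (inv (1 + M)), inv_mul _ h1, one_mul]
    _ = inv (1 + M) * comp R (leftDilate (1 + M)) := by
        rw [← comp_leftDilate_mul, mul_assoc, mul_assoc, mul_inv _ h1, mul_one]

theorem adj_etaOf (M : NCSeries d) (hM : M [] = 0) (hMa : adj M = M) : adj (etaOf M) = etaOf M := by
  rw [etaOf, adj_sub, adj_inv _ (by simp [add_apply, one_apply, hM]), adj_add, adj_one, hMa]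

theorem adj_momentOfEta (E : NCSeries d) (hE : E [] = 0) (hEa : adj E = E) :
    adj (momentOfEta E) = momentOfEta E := by
  rw [momentOfEta, adj_sub, adj_inv _ (by simp [sub_apply, one_apply, hE]), adj_sub, adj_one, hEa]

theorem comp_leftDilate_of_adj (R M : NCSeries d) (hM : M [] = 0)
    (h : comp R (fun i => X i * (1 + M)) = M) : comp R (leftDilate (1 + M)) = M := by
  have h1 : (1 + M) [] = 1 := by simp [add_apply, one_apply, hM]
  have := comp_leftDilate_mul R (1 + M)
  rw [h, show (1 + M) * M = M * (1 + M) by noncomm_ring] at this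
  have h2 := congrArg (· * inv (1 + M)) this
  simpa only [mul_assoc, mul_inv _ h1, mul_one] using h2

theorem adj_freeOf (M : NCSeries d) (hM : M [] = 0) (hMa : adj M = M) :
    adj (freeOf M) = freeOf M := by
  refine freeOf_unique _ _ hM (comp_leftDilate_of_adj _ _ hM ?_)
  have := congrArg adj (freeOf_spec M hM)
  rw [adj_comp, hMa] at this
  simpa only [adj_leftDilate, adj_add, adj_one, hMa] using this

theorem adj_momentOfFree (R : NCSeries d) (hR : R [] = 0) (hRa : adj R = R) :
    adj (momentOfFree R) = momentOfFree R := by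
  refine momentOfFree_unique _ _ (comp_leftDilate_of_adj _ _ ?_ ?_)
  · rw [adj_apply, List.reverse_nil, momentOfFree_nil R hR, map_zero]
  have := congrArg adj (momentOfFree_spec R)
  rw [adj_comp, hRa] at this
  simpa only [adj_leftDilate, adj_add, adj_one] using this

end NCSeries

/-! ### Non-commutative polynomials and functionals on them -/

/-- The algebra `ℂ⟨x_1, ..., x_d⟩` of polynomials in `d` non-commuting variables. -/
abbrev NCPoly (d : ℕ) : Type := MonoidAlgebra ℂ (FreeMonoid (Fin d))

namespace NCPoly

variable {d : ℕ}

/-- The monomial `x_{u(1)} ... x_{u(n)}`. -/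
noncomputable def mon (u : List (Fin d)) : NCPoly d := MonoidAlgebra.single (FreeMonoid.ofList u) 1

/-- The variable `x i`. -/
noncomputable def x (i : Fin d) : NCPoly d := mon [i]

/-- The involution of `ℂ⟨x_1, ..., x_d⟩`: conjugate-linear, with
`(x_{u(1)} ... x_{u(n)})* = x_{u(n)} ... x_{u(1)}`. -/
noncomputable def adj (p : NCPoly d) : NCPoly d :=
  p.coeff.sum fun u c => MonoidAlgebra.single (FreeMonoid.ofList u.toList.reverse) (conj c)

theorem mon_mul (u v : List (Fin d)) : mon u * mon v = mon (u ++ v) := by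
  simp [mon, MonoidAlgebra.single_mul_single]

theorem mon_nil : mon ([] : List (Fin d)) = 1 := rfl

theorem adj_single (u : FreeMonoid (Fin d)) (c : ℂ) : adj (MonoidAlgebra.single u c) =
    MonoidAlgebra.single (FreeMonoid.ofList u.toList.reverse) (conj c) := by
  simp [adj]

theorem adj_add (p q : NCPoly d) : adj (p + q) = adj p + adj q := by
  unfold adj
  rw [MonoidAlgebra.coeff_add, Finsupp.sum_add_index'] <;> simp

end NCPoly

/-- A functional on `ℂ⟨x_1, ..., x_d⟩`: linear, unital and compatible with the involution. -/
structure Functional (d : ℕ) where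
  toLin : NCPoly d →ₗ[ℂ] ℂ
  map_one : toLin 1 = 1
  map_adj : ∀ p, toLin p.adj = conj (toLin p)

namespace Functional

variable {d : ℕ}

noncomputable instance : CoeFun (Functional d) fun _ => NCPoly d → ℂ := ⟨fun φ => φ.toLin⟩

/-- A state: a positive definite functional. -/
def IsState (φ : Functional d) : Prop :=
  ∀ p : NCPoly d, 0 ≤ (φ (p.adj * p)).re ∧ (φ (p.adj * p)).im = 0

/-- The mean vector `(φ[x_1], ..., φ[x_d])`. -/
noncomputable def mean (φ : Functional d) : Fin d → ℂ := fun i => φ (NCPoly.x i)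

/-- The covariance matrix `φ[x_i x_j] - φ[x_i] φ[x_j]`. -/
noncomputable def cov (φ : Functional d) : Matrix (Fin d) (Fin d) ℂ :=
  Matrix.of fun i j => φ (NCPoly.x i * NCPoly.x j) - φ (NCPoly.x i) * φ (NCPoly.x j)

/-- The moment generating function `M^φ`, without constant term. -/
noncomputable def M (φ : Functional d) : NCSeries d :=
  fun u => if u = [] then 0 else φ (NCPoly.mon u)

theorem M_nil (φ : Functional d) : φ.M [] = 0 := by simp [M]

theorem apply_mon (φ : Functional d) (u : List (Fin d)) : φ (NCPoly.mon u) = (1 + φ.M) u := by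
  by_cases h : u = []
  · subst h; simp [NCSeries.add_apply, NCSeries.one_apply, M_nil, NCPoly.mon_nil, φ.map_one]
  · simp [NCSeries.add_apply, NCSeries.one_apply, M, h]

theorem adj_M (φ : Functional d) : NCSeries.adj φ.M = φ.M := by
  ext u
  have := φ.map_adj (NCPoly.mon u.reverse)
  by_cases h : u = []
  · simp [NCSeries.adj, M, h]
  · simp only [NCSeries.adj, M, List.reverse_eq_nil_iff, h, if_false]
    rw [← this, NCPoly.mon, NCPoly.adj_single]
    simp [NCPoly.mon]

/-- The functional with prescribed moment generating function `F`. -/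
noncomputable def ofM (F : NCSeries d) (h0 : F [] = 0) (ha : F.adj = F) : Functional d where
  toLin := (Finsupp.linearCombination ℂ fun u : FreeMonoid (Fin d) => (1 + F) u.toList).comp
    (MonoidAlgebra.coeffLinearEquiv ℂ).toLinearMap
  map_one := by
    rw [MonoidAlgebra.one_def]
    simp [NCSeries.add_apply, NCSeries.one_apply, h0]
  map_adj p := by
    have h1 : NCSeries.adj (1 + F) = 1 + F := by rw [NCSeries.adj_add, NCSeries.adj_one, ha]
    induction p using MonoidAlgebra.induction_linear with
    | zero => simp [NCPoly.adj]
    | add p q hp hq => rw [NCPoly.adj_add, map_add, hp, hq, map_add, map_add]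
    | single u c =>
      rw [NCPoly.adj_single]
      have := congrFun h1 u.toList.reverse
      rw [NCSeries.adj_apply, List.reverse_reverse] at this
      simp [← this]

theorem M_ofM (F : NCSeries d) (h0 : F [] = 0) (ha : F.adj = F) : (ofM F h0 ha).M = F := by
  ext u
  by_cases h : u = []
  · subst h; rw [M_nil, h0]
  · simp [M, ofM, NCPoly.mon, h, NCSeries.add_apply, NCSeries.one_apply]

theorem ext_M {φ ψ : Functional d} (h : φ.M = ψ.M) : φ = ψ := by
  have : φ.toLin = ψ.toLin := by
    refine LinearMap.ext fun p => ?_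
    induction p using MonoidAlgebra.induction_linear with
    | zero => simp
    | add p q hp hq => rw [map_add, map_add, hp, hq]
    | single u c =>
      have e : (MonoidAlgebra.single u c : NCPoly d) = c • NCPoly.mon u.toList := by
        simp [NCPoly.mon]
      rw [e, map_smul, map_smul, apply_mon, apply_mon, h]
  cases φ; cases ψ; simp at this; simp [this]

/-- The Boolean cumulant generating function `η^φ = 1 - (1 + M^φ)⁻¹`. -/
noncomputable def eta (φ : Functional d) : NCSeries d := φ.M.etaOf

/-- The free cumulant generating function `R^φ`, where `M^φ(w) = R^φ((1 + M^φ(w)) w)`. -/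
noncomputable def R (φ : Functional d) : NCSeries d := φ.M.freeOf

theorem R_spec (φ : Functional d) : φ.R.comp (NCSeries.leftDilate (1 + φ.M)) = φ.M :=
  NCSeries.freeOf_spec _ φ.M_nil

theorem eta_nil (φ : Functional d) : φ.eta [] = 0 := NCSeries.etaOf_nil _
theorem R_nil (φ : Functional d) : φ.R [] = 0 := NCSeries.freeOf_nil _ φ.M_nil
theorem adj_eta (φ : Functional d) : φ.eta.adj = φ.eta := NCSeries.adj_etaOf _ φ.M_nil φ.adj_M
theorem adj_R (φ : Functional d) : φ.R.adj = φ.R := NCSeries.adj_freeOf _ φ.M_nil φ.adj_M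

theorem add_nil {F G : NCSeries d} (hF : F [] = 0) (hG : G [] = 0) : (F + G) [] = 0 := by
  rw [NCSeries.add_apply, hF, hG, add_zero]

theorem smul_nil {F : NCSeries d} (c : ℂ) (hF : F [] = 0) : (c • F) [] = 0 := by
  rw [NCSeries.smul_apply, hF, mul_zero]

theorem adj_add_eq {F G : NCSeries d} (hF : F.adj = F) (hG : G.adj = G) :
    (F + G).adj = F + G := by
  rw [NCSeries.adj_add, hF, hG]

theorem adj_real_smul_eq {F : NCSeries d} (t : ℝ) (hF : F.adj = F) :
    ((t : ℂ) • F).adj = (t : ℂ) • F := by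
  rw [NCSeries.adj_smul, hF, Complex.conj_ofReal]

/-- The functional with prescribed Boolean cumulant generating function. -/
noncomputable def ofEta (E : NCSeries d) (h0 : E [] = 0) (ha : E.adj = E) : Functional d :=
  ofM E.momentOfEta
    (by rw [NCSeries.momentOfEta, NCSeries.sub_apply, NCSeries.inv_nil, NCSeries.one_apply,
      if_pos rfl, sub_self])
    (NCSeries.adj_momentOfEta E h0 ha)

theorem eta_ofEta (E : NCSeries d) (h0 : E [] = 0) (ha : E.adj = E) : (ofEta E h0 ha).eta = E := by
  rw [eta, ofEta, M_ofM, NCSeries.etaOf_momentOfEta E h0]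

theorem ext_eta {φ ψ : Functional d} (h : φ.eta = ψ.eta) : φ = ψ := by
  apply ext_M
  rw [← NCSeries.momentOfEta_etaOf φ.M φ.M_nil, ← NCSeries.momentOfEta_etaOf ψ.M ψ.M_nil]
  exact congrArg _ h

/-- The functional with prescribed free cumulant generating function. -/
noncomputable def ofR (F : NCSeries d) (h0 : F [] = 0) (ha : F.adj = F) : Functional d :=
  ofM F.momentOfFree (NCSeries.momentOfFree_nil F h0) (NCSeries.adj_momentOfFree F h0 ha)

theorem R_ofR (F : NCSeries d) (h0 : F [] = 0) (ha : F.adj = F) : (ofR F h0 ha).R = F := by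
  rw [R, ofR, M_ofM]
  exact (NCSeries.freeOf_unique _ _ (NCSeries.momentOfFree_nil F h0)
    (NCSeries.momentOfFree_spec F)).symm

theorem ext_R {φ ψ : Functional d} (h : φ.R = ψ.R) : φ = ψ := by
  apply ext_M
  rw [NCSeries.momentOfFree_unique _ _ φ.R_spec, NCSeries.momentOfFree_unique _ _ ψ.R_spec, h]

/-! ### Convolutions and transformations -/

/-- Free convolution `φ ⊞ ψ`. -/
noncomputable def freeConv (φ ψ : Functional d) : Functional d :=
  ofR (φ.R + ψ.R) (add_nil φ.R_nil ψ.R_nil) (adj_add_eq φ.adj_R ψ.adj_R)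

/-- Free convolution power `φ^{⊞ t}`. -/
noncomputable def freePow (φ : Functional d) (t : ℝ) : Functional d :=
  ofR ((t : ℂ) • φ.R) (smul_nil _ φ.R_nil) (adj_real_smul_eq t φ.adj_R)

/-- Boolean convolution `φ ⊎ ψ`. -/
noncomputable def boolConv (φ ψ : Functional d) : Functional d :=
  ofEta (φ.eta + ψ.eta) (add_nil φ.eta_nil ψ.eta_nil) (adj_add_eq φ.adj_eta ψ.adj_eta)

/-- Boolean convolution power `φ^{⊎ t}`. -/
noncomputable def boolPow (φ : Functional d) (t : ℝ) : Functional d :=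
  ofEta ((t : ℂ) • φ.eta) (smul_nil _ φ.eta_nil) (adj_real_smul_eq t φ.adj_eta)

/-- A freely infinitely divisible state: all `ρ^{⊞ t}`, `t ≥ 0`, are states. -/
def IsFreelyInfDiv (ρ : Functional d) : Prop := ∀ t : ℝ, 0 ≤ t → (ρ.freePow t).IsState

/-- The moments `a_{u(1)} ... a_{u(n)}`. -/
noncomputable def deltaSeries (a : Fin d → ℝ) : NCSeries d :=
  fun u => if u = [] then 0 else ((u.map a).prod : ℝ)

/-- The functional `δ_a[P] = P(a_1, ..., a_d)`, for `a ∈ ℝ^d`. -/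
noncomputable def delta (a : Fin d → ℝ) : Functional d :=
  ofM (deltaSeries a) (by simp [deltaSeries]) (by
    ext u
    by_cases h : u = []
    · simp [NCSeries.adj, deltaSeries, h]
    · simp only [NCSeries.adj, deltaSeries, List.reverse_eq_nil_iff, h, if_false,
        Complex.conj_ofReal, List.map_reverse, List.prod_reverse])

/-- The functional `Φ[ρ, ψ]`, defined by
`η^{Φ[ρ, ψ]}(w) = (1 + M^ψ(w))⁻¹ R^ρ((1 + M^ψ(w)) w)`. -/
noncomputable def Phi (ρ ψ : Functional d) : Functional d :=
  ofEta (NCSeries.inv (1 + ψ.M) * ρ.R.comp (NCSeries.leftDilate (1 + ψ.M)))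
    (NCSeries.condSeries_nil _ _ ρ.R_nil)
    (NCSeries.adj_condSeries _ _ ψ.M_nil ρ.adj_R ψ.adj_M)

theorem eta_Phi (ρ ψ : Functional d) : (Phi ρ ψ).eta =
    NCSeries.inv (1 + ψ.M) * ρ.R.comp (fun i => (1 + ψ.M) * NCSeries.X i) :=
  eta_ofEta _ _ _

/-- The one-argument map `Φ[ψ]`, defined by `η^{Φ[ψ]}(w) = ∑ i, w_i (1 + M^ψ(w)) w_i`. -/
noncomputable def PhiOne (ψ : Functional d) : Functional d :=
  ofEta (∑ i, NCSeries.X i * (1 + ψ.M) * NCSeries.X i)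
    (by
      rw [NCSeries.sum_apply]
      exact Finset.sum_eq_zero fun i _ => by simp [NCSeries.mul_nil, NCSeries.X])
    (by
      rw [NCSeries.adj_sum]
      refine Finset.sum_congr rfl fun i _ => ?_
      rw [NCSeries.adj_mul, NCSeries.adj_mul, NCSeries.adj_X, NCSeries.adj_add, NCSeries.adj_one,
        ψ.adj_M, mul_assoc])

/-- The transformation `B_{a,t}[ρ] = ((ρ^{⊞ (1 + t)} ⊞ δ_a) ⊎ δ_{-a})^{⊎ 1/(1 + t)}`, `t ≠ -1`. -/
noncomputable def B (a : Fin d → ℝ) (t : ℝ) (ρ : Functional d) : Functional d :=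
  boolPow (boolConv (freeConv (freePow ρ (1 + t)) (delta a)) (delta (-a))) (1 / (1 + t))

/-- The Boolean-to-free Bercovici-Pata bijection `B = B_{0,1}`. -/
noncomputable def BP (ρ : Functional d) : Functional d := B 0 1 ρ

instance : Nonempty (Functional d) := ⟨delta 0⟩

/-- The series which has the free cumulants of `μ` as coefficients of the powers of `z i`, and no
other terms. -/
noncomputable def marginSeries (i : Fin d) (μ : Functional 1) : NCSeries d :=
  fun u => if ∀ j ∈ u, j = i then μ.R (List.replicate u.length 0) else 0

/-- The free product of functionals in one variable: the variables `x_i` have the distributions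
`μ_i` and all their mixed free cumulants vanish. -/
noncomputable def freeProd (μ : Fin d → Functional 1) : Functional d :=
  ofR (∑ i, marginSeries i (μ i))
    (by
      rw [NCSeries.sum_apply]
      exact Finset.sum_eq_zero fun i _ => by simp [marginSeries, R_nil])
    (by
      rw [NCSeries.adj_sum]
      refine Finset.sum_congr rfl fun i _ => ?_
      ext u
      have := congrFun (μ i).adj_R (List.replicate u.length 0)
      simp only [NCSeries.adj, List.reverse_replicate] at this
      by_cases h : ∀ j ∈ u, j = i
      · simp only [NCSeries.adj, marginSeries, List.mem_reverse, List.length_reverse, if_pos h,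
          this]
      · simp only [NCSeries.adj, marginSeries, List.mem_reverse, if_neg h, map_zero])

/-! ### Functionals in one variable given by Jacobi parameters -/

/-- Multiplication by `x` in the basis `(P_n)` of polynomials with
`x P_n = P_{n+1} + β_n P_n + γ_n P_{n-1}`; a polynomial `∑ f_n P_n` is given by `f`. -/
def jacobiOp (β γ : ℕ → ℝ) : Module.End ℝ (ℕ → ℝ) where
  toFun f n := (if n = 0 then 0 else f (n - 1)) + β n * f n + γ (n + 1) * f (n + 1)
  map_add' f g := by ext n; by_cases h : n = 0 <;> simp [h] <;> ring
  map_smul' c f := by ext n; by_cases h : n = 0 <;> simp [h] <;> ring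

/-- The coefficient of `P_0 = 1` in the expansion of `x ^ n` in the polynomials `P_n`. -/
noncomputable def jacobiSeries (β γ : ℕ → ℝ) : NCSeries 1 :=
  fun u => if u = [] then 0 else ((jacobiOp β γ ^ u.length) (Pi.single 0 1) 0 : ℝ)

/-- The functional in one variable with Jacobi parameters `(β_0, β_1, ...)`, `(γ_1, γ_2, ...)`
(`γ_0` plays no role): the value at `x ^ n` is the coefficient of `P_0 = 1` in the expansion of
`x ^ n` in the polynomials `P_n`. It makes the `P_n` orthogonal, see `ofJacobi_orthogonal`. -/
noncomputable def ofJacobi (β γ : ℕ → ℝ) : Functional 1 :=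
  ofM (jacobiSeries β γ) (by simp [jacobiSeries])
    (by
      ext u
      by_cases h : u = []
      · simp [NCSeries.adj, jacobiSeries, h]
      · simp only [NCSeries.adj, jacobiSeries, List.reverse_eq_nil_iff, h, if_false, Complex.conj_ofReal,
          List.length_reverse])

/-- The monic polynomials with `P_{-1} = 0`, `P_0 = 1`,
`x P_n = P_{n+1} + β_n P_n + γ_n P_{n-1}`. -/
noncomputable def jacobiPoly (β γ : ℕ → ℝ) : ℕ → Polynomial ℝ
  | 0 => 1
  | 1 => Polynomial.X - Polynomial.C (β 0)
  | n + 2 => (Polynomial.X - Polynomial.C (β (n + 1))) * jacobiPoly β γ (n + 1)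
      - Polynomial.C (γ (n + 1)) * jacobiPoly β γ n

theorem jacobiOp_single (β γ : ℕ → ℝ) (n : ℕ) : jacobiOp β γ (Pi.single n 1) =
    Pi.single (n + 1) 1 + β n • Pi.single n 1
      + (if n = 0 then 0 else γ n • Pi.single (n - 1) 1) := by
  ext k
  simp only [jacobiOp, LinearMap.coe_mk, AddHom.coe_mk, Pi.add_apply, Pi.smul_apply, smul_eq_mul]
  rcases k with _ | k <;> rcases n with _ | n <;> simp [Pi.single_apply] <;>
    (try split_ifs) <;> grind

theorem aeval_jacobiPoly (β γ : ℕ → ℝ) (n : ℕ) :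
    Polynomial.aeval (jacobiOp β γ) (jacobiPoly β γ n) (Pi.single 0 1) = Pi.single n 1 := by
  induction n using Nat.twoStepInduction with
  | zero => simp [jacobiPoly]
  | one => simp [jacobiPoly, jacobiOp_single]
  | more n ih1 ih2 =>
    simp only [jacobiPoly, map_sub, map_mul, Polynomial.aeval_X, Polynomial.aeval_C,
      LinearMap.sub_apply, Module.End.mul_apply, ih1, ih2, jacobiOp_single,
      Module.algebraMap_end_apply, Nat.succ_ne_zero, if_false, Nat.add_sub_cancel]
    abel

theorem aeval_jacobiPoly_zero (β γ : ℕ → ℝ) (n m : ℕ) (h : n < m) :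
    Polynomial.aeval (jacobiOp β γ) (jacobiPoly β γ n) (Pi.single m 1) 0 = 0 := by
  induction n using Nat.twoStepInduction generalizing m with
  | zero => simp [jacobiPoly, Pi.single_apply]; omega
  | one =>
    have h0 : m ≠ 0 := by omega
    have h1 : m - 1 ≠ 0 := by omega
    simp [jacobiPoly, jacobiOp_single, h0, h0.symm, h1.symm]
  | more n ih1 ih2 =>
    have h0 : m ≠ 0 := by omega
    rw [jacobiPoly, mul_comm (Polynomial.X - _)]
    simp [jacobiOp_single, h0, ih1 m (by omega), ih2 m (by omega), ih2 (m + 1) (by omega),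
      ih2 (m - 1) (by omega)]

theorem ofJacobi_aeval (β γ : ℕ → ℝ) (P : Polynomial ℝ) :
    ofJacobi β γ (Polynomial.aeval (NCPoly.x 0) P) =
      (Polynomial.aeval (jacobiOp β γ) P (Pi.single 0 1) 0 : ℝ) := by
  have hpow : ∀ n : ℕ, (NCPoly.x 0 : NCPoly 1) ^ n = NCPoly.mon (List.replicate n 0) := by
    intro n
    induction n with
    | zero => simp [NCPoly.mon_nil]
    | succ n ih => rw [pow_succ, ih, NCPoly.x, NCPoly.mon_mul, List.replicate_succ']
  induction P using Polynomial.induction_on' with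
  | add p q hp hq => simp [hp, hq]
  | monomial n c =>
    rw [Polynomial.aeval_monomial, Polynomial.aeval_monomial, hpow, ← Algebra.smul_def,
      ← Algebra.smul_def]
    have : (c • NCPoly.mon (List.replicate n 0) : NCPoly 1) =
        (c : ℂ) • NCPoly.mon (List.replicate n 0) := by
      simp [NCPoly.mon]
    rw [this, map_smul, apply_mon, ofJacobi, M_ofM]
    rcases n with _ | n <;> simp [NCSeries.add_apply, NCSeries.one_apply, jacobiSeries]

theorem ofJacobi_orthogonal (β γ : ℕ → ℝ) (m n : ℕ) (h : m ≠ n) :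
    ofJacobi β γ (Polynomial.aeval (NCPoly.x 0) (jacobiPoly β γ m * jacobiPoly β γ n)) = 0 := by
  wlog hmn : m < n generalizing m n
  · rw [mul_comm]; exact this n m h.symm (by omega)
  rw [ofJacobi_aeval, map_mul, Module.End.mul_apply, aeval_jacobiPoly,
    aeval_jacobiPoly_zero _ _ _ _ hmn, Complex.ofReal_zero]

/-- The normalized free Meixner distribution `μ_{b,c}`, with Jacobi parameters
`(0, b, b, ...)`, `(1, 1 + c, 1 + c, ...)`. In particular `μ_{0,0}` is the standard semicircular
distribution and the `μ_{b,0}` are the centered free Poisson distributions. -/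
noncomputable def freeMeixner (b c : ℝ) : Functional 1 :=
  ofJacobi (fun n => if n = 0 then 0 else b) (fun n => if n = 1 then 1 else 1 + c)

end Functional

/-!
A functional is a state exactly when its moment series has a positive semidefinite Hankel kernel on
all words, and equivalently when its Boolean cumulant series has one on the non-empty words. The
coefficients of `η^{Φ[ρ, ψ]}` arise by inserting `1 + M^ψ` between consecutive letters of the words
of `R^ρ`. They are vacuum coefficients of operators, one for each letter, which are symmetric for
the tensor product of the kernels of `1 + M^ψ` and `R^ρ`, so positivity of these two kernels gives
positivity of the third. Since `Φ[ρ, ρ] = ρ` and the coefficients of `η^{Φ[ρ, ψ]}` involve only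
shorter moments of `ψ`, `ρ` is the limit of the iterates of `Φ[ρ, ·]`. Hence positivity of the
kernel of `R^ρ` on the non-empty words makes `ρ` a state, and so characterises free infinite
divisibility.

If `ψ` and `ψ'` first differ at length `m`, and `n` is the least positive length of a word in a
left derivative of `R^ρ`, then the leading difference between the corresponding series is the
insertion of `M^ψ - M^ψ'` into the words of length `n`. The lexicographically greatest word so
obtained cannot cancel, so `ψ` is determined by `ρ` and `Φ[ρ, ψ]`.

The ranges of `Φ[ρ, ·]` and `Φ[·, ψ]` are tested on the states whose Boolean cumulant series is
`∑ i, w_i (1 - ∑ j, a i j w_j)⁻¹ w_i`. In several variables their coefficients of order three are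
too independent for `Φ[ρ, ·]` to reach them all. For `a = 0` the coefficients of order four vanish,
which forces the equality case of the Cauchy-Schwarz inequality for both `ρ` and `ψ`: then `ψ` is
a point mass and, in one variable, `ρ` is free Poisson.
-/

namespace NCSeries

variable {d : ℕ}

/-! ### Products and compositions of series -/

theorem AgreeTo.refl (n : ℕ) (F : NCSeries d) : AgreeTo n F F := fun _ _ => rfl

theorem agreeTo_zero (F G : NCSeries d) : AgreeTo 0 F G :=
  fun u hu => absurd hu u.length.not_lt_zero

theorem AgreeTo.mul_left_of_nil {n : ℕ} {H F G : NCSeries d} (hH : H [] = 0)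
    (h : AgreeTo n F G) : AgreeTo (n + 1) (H * F) (H * G) := by
  intro u hu
  cases u with
  | nil => rw [mul_nil, mul_nil, hH, zero_mul, zero_mul]
  | cons i u =>
    rw [mul_cons, mul_cons, hH, zero_mul, zero_mul,
      (AgreeTo.refl n (leftD i H)).mul h u (Nat.succ_lt_succ_iff.1 hu)]

/-- The right derivative, the mirror image of the left derivative `leftD`. -/
def rightD (i : Fin d) (F : NCSeries d) : NCSeries d := fun u => F (u ++ [i])

theorem leftD_apply (i : Fin d) (F : NCSeries d) (u : List (Fin d)) : leftD i F u = F (i :: u) :=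
  rfl

theorem rightD_apply (i : Fin d) (F : NCSeries d) (u : List (Fin d)) :
    rightD i F u = F (u ++ [i]) := rfl

theorem adj_leftD (i : Fin d) (F : NCSeries d) : adj (leftD i F) = rightD i (adj F) := by
  ext u; simp [adj_apply, leftD_apply, rightD_apply]

theorem mul_concat (F G : NCSeries d) (i : Fin d) (u : List (Fin d)) :
    (F * G) (u ++ [i]) = (F * rightD i G) u + F (u ++ [i]) * G [] := by
  simp only [mul_apply, List.length_append, List.length_singleton]
  rw [sum_range_succ, List.take_of_length_le (by simp), List.drop_of_length_le (by simp)]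
  congr 1
  refine sum_congr rfl fun k hk => ?_
  rw [mem_range] at hk
  rw [List.take_append_of_le_length (by omega), List.drop_append_of_le_length (by omega),
    rightD_apply]

theorem leftD_mul (i : Fin d) (F G : NCSeries d) :
    leftD i (F * G) = leftD i F * G + F [] • leftD i G := by
  ext u; exact mul_cons F G i u

theorem leftD_one (i : Fin d) : leftD i (1 : NCSeries d) = 0 := by
  ext u; simp [leftD_apply, one_apply, zero_apply]

theorem leftD_X (i j : Fin d) : leftD j (X i : NCSeries d) = if j = i then 1 else 0 := by
  ext u
  by_cases h : j = i <;> simp [leftD_apply, X, one_apply, zero_apply, h]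

theorem X_nil (i : Fin d) : (X i : NCSeries d) [] = 0 := by simp [X]

theorem rightD_X (i j : Fin d) : rightD j (X i : NCSeries d) = if j = i then 1 else 0 := by
  rw [← adj_X i, ← adj_leftD, leftD_X]
  split_ifs
  · exact adj_one
  · ext u; simp [adj_apply, zero_apply]

theorem ext_cons_concat {F G : NCSeries d} (h_nil : F [] = G []) (h_singleton : ∀ i, F [i] = G [i])
    (h_cons_concat : ∀ i j u, F (i :: (u ++ [j])) = G (i :: (u ++ [j]))) : F = G := by
  ext u
  rcases u with _ | ⟨i, u⟩
  · exact h_nil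
  · rcases u.eq_nil_or_concat with rfl | ⟨v, j, rfl⟩
    · exact h_singleton i
    · rw [List.concat_eq_append]
      exact h_cons_concat i j v

theorem sum_X_mul_cons (F : Fin d → NCSeries d) (j : Fin d) (u : List (Fin d)) :
    (∑ i, X i * F i) (j :: u) = F j u := by
  rw [sum_apply, sum_eq_single j]
  · simp [mul_cons, leftD_X, X_nil]
  · intro i _ hi; simp [mul_cons, leftD_X, X_nil, hi.symm, zero_apply]
  · simp

theorem sum_mul_X_concat (F : Fin d → NCSeries d) (j : Fin d) (u : List (Fin d)) :
    (∑ i, F i * X i) (u ++ [j]) = F j u := by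
  rw [sum_apply, sum_eq_single j]
  · simp [mul_concat, rightD_X, X_nil]
  · intro i _ hi; simp [mul_concat, rightD_X, X_nil, hi.symm, zero_apply]
  · simp

/-- Composition `F ↦ F(H_1, ..., H_d)` with a fixed tuple, as a linear map in the outer series. -/
noncomputable def compLinear (H : Fin d → NCSeries d) : NCSeries d →ₗ[ℂ] NCSeries d where
  toFun F := comp F H
  map_add' F G := by ext u; simp only [comp, add_apply, add_mul, sum_add_distrib]
  map_smul' c F := by ext u; simp only [comp, smul_apply, mul_sum, mul_assoc, RingHom.id_apply]

theorem add_comp (F G : NCSeries d) (H : Fin d → NCSeries d) :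
    comp (F + G) H = comp F H + comp G H := map_add (compLinear H) F G

theorem sub_comp (F G : NCSeries d) (H : Fin d → NCSeries d) :
    comp (F - G) H = comp F H - comp G H := map_sub (compLinear H) F G

theorem smul_comp (c : ℂ) (F : NCSeries d) (H : Fin d → NCSeries d) :
    comp (c • F) H = c • comp F H := map_smul (compLinear H) c F

theorem zero_comp (H : Fin d → NCSeries d) : comp 0 H = 0 := map_zero (compLinear H)

theorem sum_comp {ι : Type*} (s : Finset ι) (F : ι → NCSeries d) (H : Fin d → NCSeries d) :
    comp (∑ i ∈ s, F i) H = ∑ i ∈ s, comp (F i) H := map_sum (compLinear H) F s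

theorem compTrunc_succ (n : ℕ) (F : NCSeries d) (H : Fin d → NCSeries d) :
    compTrunc (n + 1) F H = F [] • 1 + ∑ i, H i * compTrunc n (leftD i F) H := by
  rw [compTrunc, sum_range_succ', add_comm]
  congr 1
  · simp
  · simp only [compTrunc, mul_sum]
    rw [sum_comm]
    refine sum_congr rfl fun k _ => ?_
    rw [← (Fin.consEquiv fun _ => Fin d).sum_comp, Fintype.sum_prod_type]
    refine sum_congr rfl fun i _ => sum_congr rfl fun v _ => ?_
    simp [Fin.consEquiv, List.ofFn_succ, leftD_apply, NCSeries.mul_smul']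

section Substitution

variable {H : Fin d → NCSeries d}

theorem comp_eq_sum_leftD (F : NCSeries d) (hH : ∀ i, H i [] = 0) :
    comp F H = F [] • 1 + ∑ i, H i * comp (leftD i F) H := by
  refine eq_of_agreeTo fun n u hu => ?_
  rw [agreeTo_comp F H hH (n + 1) u (by omega), compTrunc_succ, add_apply, add_apply, sum_apply,
    sum_apply]
  congr 1
  refine sum_congr rfl fun i _ => ?_
  exact (AgreeTo.mul_left_of_nil (hH i) (agreeTo_comp (leftD i F) H hH n) u (by omega)).symm

theorem comp_eq_sum_rightD (F : NCSeries d) (hH : ∀ i, H i [] = 0) :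
    comp F H = F [] • 1 + ∑ i, comp (rightD i F) H * H i := by
  have h := congrArg adj (comp_eq_sum_leftD (adj F) (H := fun i => adj (H i))
    fun i => by simp [adj_apply, hH])
  rw [adj_comp, adj_add, adj_smul, adj_one, adj_sum] at h
  simpa only [adj_adj, adj_mul, adj_comp, adj_leftD, adj_apply, List.reverse_nil,
    Complex.conj_conj] using h

theorem one_comp (hH : ∀ i, H i [] = 0) : comp 1 H = 1 := by
  rw [comp_eq_sum_leftD _ hH]
  simp [leftD_one, zero_comp, one_apply]

theorem X_comp (i : Fin d) (hH : ∀ i, H i [] = 0) : comp (X i) H = H i := by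
  rw [comp_eq_sum_leftD _ hH, X_nil, zero_smul, zero_add, sum_eq_single i]
  · rw [leftD_X, if_pos rfl, one_comp hH, mul_one]
  · intro j _ hj; rw [leftD_X, if_neg hj, zero_comp, mul_zero]
  · simp

theorem mul_comp (F G : NCSeries d) (hH : ∀ i, H i [] = 0) :
    comp (F * G) H = comp F H * comp G H := by
  refine eq_of_agreeTo fun n => ?_
  induction n generalizing F with
  | zero => exact agreeTo_zero _ _
  | succ n ih =>
    have h_mul_comp : comp F H * comp G H = F [] • comp G H +
        ∑ i, H i * (comp (leftD i F) H * comp G H) := by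
      conv_lhs => rw [comp_eq_sum_leftD F hH]
      simp only [add_mul, NCSeries.smul_mul', one_mul, sum_mul, mul_assoc]
    have h_comp_mul : comp (F * G) H = F [] • comp G H + ∑ i, H i * comp (leftD i F * G) H := by
      rw [comp_eq_sum_leftD (F * G) hH, comp_eq_sum_leftD G hH]
      simp only [leftD_mul, add_comp, smul_comp, mul_add, sum_add_distrib, mul_nil,
        NCSeries.mul_smul', smul_add, smul_smul, smul_sum]
      abel
    intro u hu
    rw [h_mul_comp, h_comp_mul, add_apply, add_apply, sum_apply, sum_apply]
    congr 1
    exact sum_congr rfl fun i _ => AgreeTo.mul_left_of_nil (hH i) (ih _) u hu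

theorem comp_assoc (F : NCSeries d) {K : Fin d → NCSeries d} (hH : ∀ i, H i [] = 0)
    (hK : ∀ i, K i [] = 0) : comp (comp F H) K = comp F fun i => comp (H i) K := by
  have hHK : ∀ i, comp (H i) K [] = 0 := fun i => by rw [comp_nil, hH]
  refine eq_of_agreeTo fun n => ?_
  induction n generalizing F with
  | zero => exact agreeTo_zero _ _
  | succ n ih =>
    intro u hu
    rw [comp_eq_sum_leftD F hH, comp_eq_sum_leftD F hHK, add_comp, smul_comp, one_comp hK,
      sum_comp, add_apply, add_apply, sum_apply, sum_apply]
    congr 1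
    refine sum_congr rfl fun i _ => ?_
    rw [mul_comp _ _ hK]
    exact AgreeTo.mul_left_of_nil (hHK i) (ih _) u hu

theorem inv_comp {F : NCSeries d} (hF : F [] = 1) (hH : ∀ i, H i [] = 0) :
    comp (inv F) H = inv (comp F H) := by
  refine (inv_eq_of_mul_eq_one (by rw [comp_nil, hF]) ?_).symm
  rw [← mul_comp _ _ hH, mul_inv F hF, one_comp hH]

end Substitution

/-! ### Substitution of `G w` -/

theorem comp_leftDilate_comp (F G K : NCSeries d) :
    comp (comp F (leftDilate G)) (leftDilate K) =
      comp F (leftDilate (comp G (leftDilate K) * K)) := by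
  rw [comp_assoc _ (leftDilate_nil G) (leftDilate_nil K)]
  congr 1
  funext i
  simp only [leftDilate, mul_comp _ _ (leftDilate_nil K), X_comp _ (leftDilate_nil K), mul_assoc]

theorem comp_leftDilate_one (F : NCSeries d) : comp F (leftDilate 1) = F := by
  refine eq_of_agreeTo fun n => ?_
  induction n generalizing F with
  | zero => exact agreeTo_zero _ _
  | succ n ih =>
    intro u hu
    rw [comp_eq_sum_leftD F (leftDilate_nil 1)]
    cases u with
    | nil => simp [add_apply, smul_apply, one_apply, sum_apply, mul_nil, leftDilate_nil]
    | cons i u =>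
      simp only [leftDilate, one_mul, add_apply, smul_apply, one_apply, sum_X_mul_cons]
      simpa [leftD_apply] using ih (leftD i F) u (by simpa using hu)

theorem comp_leftDilate_concat (F G : NCSeries d) (u : List (Fin d)) (j : Fin d) :
    comp F (leftDilate G) (u ++ [j]) = (comp (rightD j F) (leftDilate G) * G) u := by
  rw [comp_eq_sum_rightD F (leftDilate_nil G), add_apply]
  simp only [leftDilate, ← mul_assoc, sum_mul_X_concat]
  simp [smul_apply, one_apply]

theorem comp_leftDilate_singleton (F : NCSeries d) {G : NCSeries d} (hG : G [] = 1) (j : Fin d) :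
    comp F (leftDilate G) [j] = F [j] := by
  rw [← List.nil_append [j], comp_leftDilate_concat, mul_nil, comp_nil, hG, mul_one, rightD_apply]

theorem comp_leftDilate_pair (F : NCSeries d) {G : NCSeries d} (hG : G [] = 1) (j k : Fin d) :
    comp F (leftDilate G) [j, k] = F [j, k] + F [k] * G [j] := by
  have h := comp_leftDilate_concat F G [j] k
  rw [List.singleton_append] at h
  rw [h, mul_cons, mul_nil, comp_nil, hG, mul_one, leftD_apply, comp_leftDilate_singleton _ hG]
  rfl

theorem comp_leftDilate_injective {G : NCSeries d} (hG : G [] = 1) :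
    Function.Injective fun F : NCSeries d => comp F (leftDilate G) := by
  intro F F' h
  refine eq_of_agreeTo fun n => ?_
  induction n with
  | zero => exact agreeTo_zero _ _
  | succ n ih =>
    intro u hu
    have hlower : ∀ k ∈ range u.length, ∀ v : Fin k → Fin d,
        F (List.ofFn v) = F' (List.ofFn v) := fun k hk v =>
      ih _ (by rw [mem_range] at hk; rw [List.length_ofFn]; omega)
    have hu_eq := congrFun h u
    simp only [comp_leftDilate_apply _ G hG] at hu_eq
    rw [sum_congr rfl fun k hk => sum_congr rfl fun v _ => by rw [hlower k hk v]] at hu_eq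
    exact add_left_cancel hu_eq

theorem one_add_nil {M : NCSeries d} (hM : M [] = 0) : (1 + M) [] = 1 := by
  simp [add_apply, one_apply, hM]

theorem one_add_cons (M : NCSeries d) (i : Fin d) (u : List (Fin d)) :
    (1 + M) (i :: u) = M (i :: u) := by
  simp [add_apply, one_apply]

section CondSeries

variable {R M : NCSeries d}

theorem condSeries_eq_sum (hR : R [] = 0) (hM : M [] = 0) :
    condSeries R M = ∑ i, X i * comp (leftD i R) (leftDilate (1 + M)) := by
  rw [condSeries, comp_eq_sum_leftD R (leftDilate_nil _), hR, zero_smul, zero_add, mul_sum]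
  simp only [leftDilate, ← mul_assoc, inv_mul _ (one_add_nil hM), one_mul]

theorem condSeries_cons (hR : R [] = 0) (hM : M [] = 0) (i : Fin d) (u : List (Fin d)) :
    condSeries R M (i :: u) = comp (leftD i R) (leftDilate (1 + M)) u := by
  rw [condSeries_eq_sum hR hM, sum_X_mul_cons]

theorem condSeries_singleton (hR : R [] = 0) (hM : M [] = 0) (i : Fin d) :
    condSeries R M [i] = R [i] := by
  rw [condSeries_cons hR hM, comp_nil, leftD_apply]

theorem condSeries_pair (hR : R [] = 0) (hM : M [] = 0) (i j : Fin d) :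
    condSeries R M [i, j] = R [i, j] := by
  rw [condSeries_cons hR hM, comp_leftDilate_singleton _ (one_add_nil hM), leftD_apply]

theorem condSeries_triple (hR : R [] = 0) (hM : M [] = 0) (i j k : Fin d) :
    condSeries R M [i, j, k] = R [i, j, k] + R [i, k] * M [j] := by
  rw [condSeries_cons hR hM, comp_leftDilate_pair _ (one_add_nil hM), one_add_cons]; rfl

theorem condSeries_quadruple (hR : R [] = 0) (hM : M [] = 0) (i j k l : Fin d) :
    condSeries R M [i, j, k, l] =
      R [i, j, k, l] + R [i, k, l] * M [j] + R [i, j, l] * M [k] + R [i, l] * M [j, k] := by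
  have hM1 := one_add_nil hM
  have h := comp_leftDilate_concat (leftD i R) (1 + M) [j, k] l
  simp only [List.cons_append, List.nil_append] at h
  rw [condSeries_cons hR hM, h, mul_cons, mul_cons, mul_nil]
  simp only [leftD_apply, comp_nil, hM1, comp_leftDilate_singleton _ hM1,
    comp_leftDilate_pair _ hM1, rightD_apply, one_add_cons, mul_one, List.cons_append,
    List.nil_append]

end CondSeries

section BooleanCumulants

theorem inv_one_add (M : NCSeries d) : inv (1 + M) = 1 - etaOf M := by
  rw [etaOf, sub_sub_cancel]

variable {M : NCSeries d}

theorem etaOf_mul (hM : M [] = 0) : etaOf M * (1 + M) = M := by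
  rw [etaOf, sub_mul, inv_mul _ (one_add_nil hM), one_mul, add_sub_cancel_left]

theorem mul_etaOf (hM : M [] = 0) : (1 + M) * etaOf M = M := by
  rw [etaOf, mul_sub, mul_inv _ (one_add_nil hM), mul_one, add_sub_cancel_left]

theorem etaOf_eq_of_mul_eq {E : NCSeries d} (hM : M [] = 0) (h : E * (1 + M) = M) : etaOf M = E :=
  calc etaOf M = etaOf M * (1 + M) * inv (1 + M) := by
        rw [mul_assoc, mul_inv _ (one_add_nil hM), mul_one]
    _ = E * (1 + M) * inv (1 + M) := by rw [etaOf_mul hM, h]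
    _ = E := by rw [mul_assoc, mul_inv _ (one_add_nil hM), mul_one]

end BooleanCumulants

end NCSeries

/-! ### Positive semidefinite kernels -/

section SesquilinearForms

variable {R V n m : Type*} [CommRing R] [StarRing R]

/-- The sesquilinear form `∑ star (x i) * K i j * y j` of a kernel `K`, on finitely supported
functions. -/
noncomputable def kernelForm (K : Matrix n n R) : (n →₀ R) →ₗ⋆[R] (n →₀ R) →ₗ[R] R where
  toFun x := x.sum fun i a => star a • Finsupp.linearCombination R fun j => K i j
  map_add' x y := by
    classical exact Finsupp.sum_add_index' (by simp) (by simp [add_smul])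
  map_smul' c x := by
    rw [Finsupp.sum_smul_index' (by simp), Finsupp.smul_sum]
    simp only [smul_eq_mul, star_mul', mul_smul, starRingEnd_apply]

theorem kernelForm_apply (K : Matrix n n R) (x y : n →₀ R) :
    kernelForm K x y = x.sum fun i a => y.sum fun j b => star a * K i j * b := by
  simp only [kernelForm, LinearMap.coe_mk, AddHom.coe_mk, Finsupp.sum, LinearMap.sum_apply,
    LinearMap.smul_apply, Finsupp.linearCombination_apply, smul_eq_mul, mul_sum]
  exact sum_congr rfl fun i _ => sum_congr rfl fun j _ => by ring

@[simp] theorem kernelForm_single (K : Matrix n n R) (i j : n) (a b : R) :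
    kernelForm K (Finsupp.single i a) (Finsupp.single j b) = star a * K i j * b := by
  simp [kernelForm_apply]

theorem kernelForm_apply_eq_of_single {K : Matrix n n R} {Y : Module.End R (n →₀ R)}
    (h : ∀ i j, kernelForm K (Y (Finsupp.single i 1)) (Finsupp.single j 1) =
      kernelForm K (Finsupp.single i 1) (Y (Finsupp.single j 1))) (x y : n →₀ R) :
    kernelForm K (Y x) y = kernelForm K x (Y y) :=
  congr($(LinearMap.ext_basis (B := (kernelForm K).comp Y) (B' := (kernelForm K).compl₂ Y)
    Finsupp.basisSingleOne Finsupp.basisSingleOne (by simpa using h)) x y)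

variable [AddCommGroup V] [Module R V] {B : V →ₗ⋆[R] V →ₗ[R] R}

theorem apply_prod_map_eq_prod_map_reverse {ι : Type*} {Y : ι → Module.End R V}
    (hY : ∀ i x y, B (Y i x) y = B x (Y i y)) (u : List ι) (x y : V) :
    B ((u.map Y).prod x) y = B x ((u.reverse.map Y).prod y) := by
  induction u generalizing y with
  | nil => rfl
  | cons i u ih => simp [hY, ih]

variable [PartialOrder R]

theorem kernelForm_isPosSemidef {K : Matrix n n R} (hK : K.PosSemidef) :
    (kernelForm K).IsPosSemidef where
  eq := ((LinearMap.isSymm_iff_basis Finsupp.basisSingleOne).2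
    fun i j => by simpa using hK.1.apply j i).eq
  nonneg x := by rw [kernelForm_apply]; exact hK.2 x

theorem posSemidef_of_apply_eq (hB : B.IsPosSemidef) {K : Matrix n n R} {v : n → V}
    (hK : ∀ a b, K a b = B (v a) (v b)) : K.PosSemidef := by
  refine ⟨Matrix.ext fun a b => ?_, fun x => ?_⟩
  · rw [Matrix.conjTranspose_apply, hK, hK]
    exact hB.eq (v b) (v a)
  · convert hB.nonneg (Finsupp.linearCombination R v x)
    simp only [Finsupp.linearCombination_apply, Finsupp.sum, map_sum, LinearMap.sum_apply,
      map_smul, LinearMap.map_smulₛₗ, LinearMap.smul_apply, smul_eq_mul, mul_sum, hK,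
      starRingEnd_apply]
    rw [sum_comm]
    exact sum_congr rfl fun a _ => sum_congr rfl fun b _ => by ring

theorem posSemidef_of_symmetric {ι : Type*} (hB : B.IsPosSemidef) {Y : ι → Module.End R V}
    (hY : ∀ i x y, B (Y i x) y = B x (Y i y)) {v : m → V}
    {K : Matrix (List ι × m) (List ι × m) R}
    (hK : ∀ a b, K a b = B (v a.2) (((a.1.reverse ++ b.1).map Y).prod (v b.2))) :
    K.PosSemidef :=
  posSemidef_of_apply_eq hB (v := fun a => (a.1.map Y).prod (v a.2)) fun a b => by
    simp [hK, apply_prod_map_eq_prod_map_reverse hY]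

theorem posSemidef_star_mul [StarOrderedRing R] (f : n → R) :
    (Matrix.of fun a b => star (f a) * f b).PosSemidef :=
  posSemidef_of_apply_eq (kernelForm_isPosSemidef (.one (n := Unit)))
    (v := fun a => Finsupp.single () (f a)) fun a b => by simp

end SesquilinearForms

section RCLike

open scoped ComplexOrder Matrix

variable {𝕜 n m : Type*} [RCLike 𝕜]

theorem posSemidef_of_tendsto {ι : Type*} {l : Filter ι} [l.NeBot] {K : ι → Matrix n n 𝕜}
    {L : Matrix n n 𝕜} (hK : ∀ᶠ t in l, (K t).PosSemidef)
    (h : ∀ a b, Filter.Tendsto (fun t => K t a b) l (nhds (L a b))) : L.PosSemidef := by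
  refine ⟨Matrix.ext fun a b => ?_, fun x => ?_⟩
  · refine tendsto_nhds_unique_of_eventuallyEq ((h b a).star) (h a b) ?_
    filter_upwards [hK] with t ht using ht.1.apply a b
  · refine ge_of_tendsto (x := l)
      (f := fun t => x.sum fun i a => x.sum fun j b => star a * K t i j * b) ?_ ?_
    · exact tendsto_finsetSum _ fun i _ => tendsto_finsetSum _ fun j _ =>
        ((h i j).const_mul _).mul_const _
    · filter_upwards [hK] with t ht using ht.2 x

theorem apply_eq_zero_of_apply_self_eq_zero {V : Type*} [AddCommGroup V] [Module 𝕜 V]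
    {B : V →ₗ⋆[𝕜] V →ₗ[𝕜] 𝕜} (hB : B.IsPosSemidef) {x : V} (hx : B x x = 0) (y : V) :
    B y x = 0 := by
  let core : PreInnerProductSpace.Core 𝕜 V :=
    { inner := fun x y => B x y
      conj_inner_symm := fun x y => hB.eq y x
      re_inner_nonneg := fun x => (RCLike.nonneg_iff.1 (hB.nonneg x)).1
      add_left := fun x y z => by simp
      smul_left := fun x y r => by simp }
  have cauchy_schwarz : ‖B y x‖ * ‖B x y‖ ≤ RCLike.re (B y y) * RCLike.re (B x x) :=
    InnerProductSpace.Core.inner_mul_inner_self_le (c := core) y x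
  rw [← hB.eq y x, RCLike.norm_conj, hx, map_zero, mul_zero] at cauchy_schwarz
  exact norm_eq_zero.1 (mul_self_eq_zero.1 (cauchy_schwarz.antisymm (mul_self_nonneg _)))

section Minor

variable {K : Matrix n n 𝕜} {p q : n}

theorem kernelForm_sub_smul_self (hq : K q q = 1) (hK : K.IsHermitian) :
    kernelForm K (Finsupp.single p 1 - K q p • Finsupp.single q 1)
      (Finsupp.single p 1 - K q p • Finsupp.single q 1) = K p p - K p q * K q p := by
  have hpq : conj (K q p) = K p q := hK.apply p q
  simp [hq, hpq]

theorem mul_apply_le_of_posSemidef (hK : K.PosSemidef) (hq : K q q = 1) :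
    K p q * K q p ≤ K p p := by
  rw [← sub_nonneg, ← kernelForm_sub_smul_self hq hK.1]
  exact (kernelForm_isPosSemidef hK).nonneg _

theorem apply_eq_mul_of_posSemidef (hK : K.PosSemidef) (hq : K q q = 1)
    (hp : K p p = K p q * K q p) (r : n) : K r p = K r q * K q p := by
  have h := apply_eq_zero_of_apply_self_eq_zero (kernelForm_isPosSemidef hK)
    ((kernelForm_sub_smul_self hq hK.1).trans (sub_eq_zero.2 hp)) (Finsupp.single r 1)
  simpa [sub_eq_zero, mul_comm] using h

end Minor

end RCLike

namespace NCSeries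

open scoped ComplexOrder

variable {d : ℕ}

/-- The kernel `F(a* b)` on all words. -/
def hankel (F : NCSeries d) : Matrix (List (Fin d)) (List (Fin d)) ℂ :=
  Matrix.of fun a b => F (a.reverse ++ b)

/-- The kernel `F((s i)* (t j))` on the non-empty words; the word `s i` is encoded as `(s, i)`. -/
def condHankel (F : NCSeries d) : Matrix (List (Fin d) × Fin d) (List (Fin d) × Fin d) ℂ :=
  Matrix.of fun a b => F (a.2 :: (a.1.reverse ++ b.1 ++ [b.2]))

/-- Conditional positivity: `F[P* P] ≥ 0` for polynomials `P` without constant term. -/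
def CondPos (F : NCSeries d) : Prop := (condHankel F).PosSemidef

theorem hankel_apply (F : NCSeries d) (a b : List (Fin d)) : hankel F a b = F (a.reverse ++ b) :=
  rfl

theorem condHankel_apply (F : NCSeries d) (a b : List (Fin d) × Fin d) :
    condHankel F a b = F (a.2 :: (a.1.reverse ++ b.1 ++ [b.2])) := rfl

theorem condHankel_congr {F F' : NCSeries d} (h : ∀ u, 2 ≤ u.length → F u = F' u) :
    condHankel F = condHankel F' := by
  ext a b
  exact h _ (by simp; omega)

theorem CondPos.smul {F : NCSeries d} (h : CondPos F) {t : ℝ} (ht : 0 ≤ t) :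
    CondPos ((t : ℂ) • F) :=
  Matrix.PosSemidef.smul h (a := (t : ℂ)) (by exact_mod_cast ht)

theorem conj_apply_of_adj_eq {F : NCSeries d} (hF : adj F = F) (u : List (Fin d)) :
    conj (F u) = F u.reverse := by
  rw [← congrFun hF u.reverse, adj_apply, List.reverse_reverse]

theorem isHermitian_hankel {F : NCSeries d} (hF : adj F = F) : (hankel F).IsHermitian := by
  ext a b
  simpa [hankel_apply] using conj_apply_of_adj_eq hF (b.reverse ++ a)

/-! ### Boolean cumulants of states -/

/-- The iterated left derivative along a word. -/
def leftShift (w : List (Fin d)) (F : NCSeries d) : NCSeries d := fun u => F (w ++ u)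

/-- The iterated right derivative along a word. -/
def rightShift (w : List (Fin d)) (F : NCSeries d) : NCSeries d := fun u => F (u ++ w)

theorem leftShift_apply (w u : List (Fin d)) (F : NCSeries d) : leftShift w F u = F (w ++ u) := rfl

theorem rightShift_apply (w u : List (Fin d)) (F : NCSeries d) : rightShift w F u = F (u ++ w) :=
  rfl

theorem leftShift_leftD (i : Fin d) (w : List (Fin d)) (F : NCSeries d) :
    leftShift w (leftD i F) = leftShift (i :: w) F := rfl

theorem rightD_rightShift (i : Fin d) (w : List (Fin d)) (F : NCSeries d) :
    rightD i (rightShift w F) = rightShift (i :: w) F := by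
  ext u; simp [rightD_apply, rightShift_apply]

theorem rightShift_nil (F : NCSeries d) : rightShift [] F = F := by
  ext u; simp [rightShift_apply]

theorem mul_append (F G : NCSeries d) (u v : List (Fin d)) :
    (F * G) (u ++ v) = (F * rightShift v G) u + (leftShift u F * G) v - F u * G v := by
  induction u generalizing F with
  | nil => rw [mul_nil]; exact (add_sub_cancel_left _ _).symm
  | cons i u ih =>
    rw [List.cons_append, mul_cons, mul_cons, ih, leftShift_leftD, leftD_apply, rightShift_apply,
      List.cons_append]
    ring

/-- Evaluation of a series on the linear span of the words. -/
noncomputable def pairing (F : NCSeries d) : (List (Fin d) →₀ ℂ) →ₗ[ℂ] ℂ :=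
  Finsupp.linearCombination ℂ F

theorem pairing_single (F : NCSeries d) (b : List (Fin d)) :
    pairing F (Finsupp.single b 1) = F b :=
  (Finsupp.linearCombination_single _ _ _).trans (one_smul _ _)

/-- The transpose of `H ↦ H * F` with respect to `pairing`. -/
noncomputable def mulRightDual (F : NCSeries d) : Module.End ℂ (List (Fin d) →₀ ℂ) :=
  Finsupp.linearCombination ℂ fun b =>
    ∑ k ∈ range (b.length + 1), F (b.drop k) • Finsupp.single (b.take k) 1

theorem mulRightDual_single (F : NCSeries d) (b : List (Fin d)) :
    mulRightDual F (Finsupp.single b 1) =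
      ∑ k ∈ range (b.length + 1), F (b.drop k) • Finsupp.single (b.take k) 1 := by
  rw [mulRightDual, Finsupp.linearCombination_single, one_smul]

theorem pairing_mulRightDual (H F : NCSeries d) (x : List (Fin d) →₀ ℂ) :
    pairing H (mulRightDual F x) = pairing (H * F) x := by
  suffices (pairing H).comp (mulRightDual F) = pairing (H * F) from congr($this x)
  refine Finsupp.basisSingleOne.ext fun b => ?_
  simp only [Finsupp.coe_basisSingleOne, LinearMap.comp_apply, mulRightDual_single, map_sum,
    map_smul, pairing_single, mul_apply, smul_eq_mul]
  exact sum_congr rfl fun k _ => mul_comm _ _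

theorem mulRightDual_mulRightDual {F G : NCSeries d} (h : F * G = 1) (x : List (Fin d) →₀ ℂ) :
    mulRightDual F (mulRightDual G x) = x := by
  have h_pairing (H : NCSeries d) :
      pairing H (mulRightDual F (mulRightDual G x)) = pairing H x := by
    rw [pairing_mulRightDual, pairing_mulRightDual, mul_assoc, h, mul_one]
  have h_coord (u : List (Fin d)) (z : List (Fin d) →₀ ℂ) :
      pairing (fun v => if u = v then 1 else 0) z = z u := by
    simp +contextual [pairing, Finsupp.linearCombination_apply, Finsupp.sum_ite_eq]
  ext u
  exact (h_coord u _).symm.trans ((h_pairing _).trans (h_coord u x))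

theorem kernelForm_mulRightDual_left (K : Matrix (List (Fin d)) (List (Fin d)) ℂ) (F : NCSeries d)
    (a : List (Fin d)) (y : List (Fin d) →₀ ℂ) {H : NCSeries d}
    (hH : ∀ c, kernelForm K (Finsupp.single c 1) y = H c.reverse) :
    kernelForm K (mulRightDual F (Finsupp.single a 1)) y = (adj F * H) a.reverse := by
  have h_adj : (adj F * H) a.reverse = conj ((adj H * F) a) := by
    rw [← adj_adj (adj F * H), adj_mul, adj_adj, adj_apply, List.reverse_reverse]
  rw [h_adj]
  simp only [mulRightDual_single, map_sum, LinearMap.sum_apply, LinearMap.map_smulₛₗ,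
    LinearMap.smul_apply, hH, adj_apply, mul_apply, map_mul, Complex.conj_conj,
    smul_eq_mul]
  exact sum_congr rfl fun k _ => mul_comm _ _

theorem kernelForm_hankel_single (G : NCSeries d) (c : List (Fin d)) (y : List (Fin d) →₀ ℂ) :
    kernelForm (hankel G) (Finsupp.single c 1) y = pairing (leftShift c.reverse G) y := by
  suffices kernelForm (hankel G) (Finsupp.single c 1) = pairing (leftShift c.reverse G) from
    congr($this y)
  refine Finsupp.basisSingleOne.ext fun b => ?_
  simp [pairing_single, leftShift_apply, hankel_apply]

/-- The Hankel kernel of `E` on non-empty words, extended to the empty word as an orthogonal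
unit vector. -/
def augmentedHankel (E : NCSeries d) : Matrix (List (Fin d)) (List (Fin d)) ℂ :=
  Matrix.of fun a b => if a = [] ∨ b = [] then if a = b then 1 else 0 else hankel E a b

-- With `F = 1 - E` inverse to `G`, the kernel of `G` is congruent to the augmented kernel of `E`.
theorem kernelForm_hankel_mulRightDual_single {E G : NCSeries d} (hE : E [] = 0) (hEa : adj E = E)
    (hFG : (1 - E) * G = 1) (hGF : G * (1 - E) = 1) (a b : List (Fin d)) :
    kernelForm (hankel G) (mulRightDual (1 - E) (Finsupp.single a 1))
      (mulRightDual (1 - E) (Finsupp.single b 1)) = augmentedHankel E a b := by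
  set F := 1 - E with hF
  have hFa : adj F = F := by rw [hF, adj_sub, adj_one, hEa]
  have h_right (c : List (Fin d)) : kernelForm (hankel G) (Finsupp.single c 1)
      (mulRightDual F (Finsupp.single b 1)) =
        (rightShift b 1 + F b • G - G * rightShift b F) c.reverse := by
    rw [kernelForm_hankel_single, pairing_mulRightDual, pairing_single]
    have h := mul_append G F c.reverse b
    rw [hGF] at h
    simp only [add_apply, sub_apply, smul_apply, rightShift_apply, h]
    ring
  rw [kernelForm_mulRightDual_left _ _ _ _ h_right, hFa, mul_sub, mul_add, ← mul_assoc, hFG,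
    one_mul, NCSeries.mul_smul', hFG]
  rcases eq_or_ne b [] with rfl | hb
  · simp [sub_apply, add_apply, rightShift_nil, augmentedHankel, hF, hE, one_apply]
  · have hb1 : rightShift b (1 : NCSeries d) = 0 := by
      ext u; simp [rightShift_apply, one_apply, zero_apply, hb]
    rw [hb1, mul_zero, zero_add, sub_apply, smul_apply]
    rcases eq_or_ne a [] with rfl | ha <;>
      simp [sub_apply, rightShift_apply, augmentedHankel, one_apply, hankel_apply, *]

theorem posSemidef_augmentedHankel {E : NCSeries d} (hE : CondPos E) :
    (augmentedHankel E).PosSemidef := by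
  have h_nil := posSemidef_star_mul fun a : List (Fin d) => if a = [] then (1 : ℂ) else 0
  have h_cons : (Matrix.of fun a b => if a = [] ∨ b = [] then 0 else hankel E a b).PosSemidef := by
    refine posSemidef_of_apply_eq (kernelForm_isPosSemidef hE) (v := fun a =>
      if h : a = [] then 0 else Finsupp.single (a.dropLast, a.getLast h) 1) fun a b => ?_
    rcases List.eq_nil_or_concat a with rfl | ⟨s, i, rfl⟩ <;>
      rcases List.eq_nil_or_concat b with rfl | ⟨t, j, rfl⟩ <;>
      simp [hankel_apply, condHankel_apply]
  suffices h_split : augmentedHankel E =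
      (Matrix.of fun a b => star (if a = [] then (1 : ℂ) else 0) * if b = [] then 1 else 0) +
        Matrix.of fun a b => if a = [] ∨ b = [] then 0 else hankel E a b from
    h_split ▸ h_nil.add h_cons
  ext a b
  by_cases ha : a = [] <;> by_cases hb : b = [] <;> simp [augmentedHankel, ha, hb]

theorem posSemidef_hankel_iff_condPos_etaOf {M : NCSeries d} (hM : M [] = 0) (ha : adj M = M) :
    (hankel (1 + M)).PosSemidef ↔ CondPos (etaOf M) := by
  have hM1 := one_add_nil hM
  have hF : inv (1 + M) = 1 - etaOf M := inv_one_add M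
  have h_form := kernelForm_hankel_mulRightDual_single (etaOf_nil M) (adj_etaOf M hM ha)
    (hF ▸ inv_mul _ hM1) (hF ▸ mul_inv _ hM1)
  constructor
  · intro h
    refine posSemidef_of_apply_eq (kernelForm_isPosSemidef h)
      (v := fun p => mulRightDual (1 - etaOf M) (Finsupp.single (p.1 ++ [p.2]) 1)) fun p q => ?_
    simp [h_form, augmentedHankel, condHankel_apply, hankel_apply]
  · intro h
    have h_forms : ((kernelForm (hankel (1 + M))).comp (mulRightDual (1 - etaOf M))).compl₂
        (mulRightDual (1 - etaOf M)) = kernelForm (augmentedHankel (etaOf M)) :=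
      LinearMap.ext_basis Finsupp.basisSingleOne Finsupp.basisSingleOne (by simpa using h_form)
    have h_inverse := mulRightDual_mulRightDual (hF ▸ inv_mul _ hM1 : (1 - etaOf M) * (1 + M) = 1)
    refine posSemidef_of_apply_eq (kernelForm_isPosSemidef (posSemidef_augmentedHankel h))
      (v := fun a => mulRightDual (1 + M) (Finsupp.single a 1)) fun a b => ?_
    simp [← h_forms, h_inverse]

/-! ### Positivity of the conditional transformation -/

/-- The tensor product of the kernels of `G` and of `R`, on pairs of a word (the current gap) and
a non-empty word (the letters chosen so far). -/
def gapKernel (R G : NCSeries d) :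
    Matrix (List (Fin d) × List (Fin d) × Fin d) (List (Fin d) × List (Fin d) × Fin d) ℂ :=
  Matrix.of fun a b => hankel G a.1 b.1 * condHankel R a.2 b.2

/-- The action of a letter on pairs of a gap and a word of chosen letters: it either extends the
current gap, or is chosen and starts a new gap. -/
noncomputable def gapOp (G : NCSeries d) (i : Fin d) :
    Module.End ℂ (List (Fin d) × List (Fin d) × Fin d →₀ ℂ) :=
  Finsupp.linearCombination ℂ fun a => Finsupp.single (i :: a.1, a.2) 1 +
    G a.1 • Finsupp.single ([], i :: a.2.1, a.2.2) 1

theorem gapOp_single (G : NCSeries d) (i : Fin d) (a : List (Fin d) × List (Fin d) × Fin d) :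
    gapOp G i (Finsupp.single a 1) = Finsupp.single (i :: a.1, a.2) 1 +
      G a.1 • Finsupp.single ([], i :: a.2.1, a.2.2) 1 := by
  simp [gapOp]

theorem posSemidef_gapKernel {R G : NCSeries d} (hG : (hankel G).PosSemidef) (hR : CondPos R) :
    (gapKernel R G).PosSemidef :=
  (hG.submatrix Prod.fst).hadamard (Matrix.PosSemidef.submatrix hR Prod.snd)

theorem kernelForm_gapOp_symm (R : NCSeries d) {G : NCSeries d} (hGa : adj G = G) (i : Fin d)
    (x y : List (Fin d) × List (Fin d) × Fin d →₀ ℂ) :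
    kernelForm (gapKernel R G) (gapOp G i x) y = kernelForm (gapKernel R G) x (gapOp G i y) := by
  refine kernelForm_apply_eq_of_single (fun a b => ?_) x y
  simp [gapOp_single, gapKernel, hankel_apply, condHankel_apply, conj_apply_of_adj_eq hGa]
  ring

theorem apply_prod_map_gapOp_single {F G : NCSeries d}
    {L : (List (Fin d) × List (Fin d) × Fin d →₀ ℂ) →ₗ[ℂ] ℂ}
    (hL : ∀ q t j, L (Finsupp.single (q, t, j) 1) = F (t ++ [j]) * G q) (b q t : List (Fin d))
    (j : Fin d) : L ((b.map (gapOp G)).prod (Finsupp.single (q, t, j) 1)) =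
      (comp (rightShift (t ++ [j]) F) (leftDilate G) * rightShift q G) b := by
  induction b using List.reverseRecOn generalizing q t j with
  | nil => simp [hL, comp_nil, rightShift_apply, mul_nil]
  | append_singleton b i ih =>
    rw [List.map_append, List.prod_append, Module.End.mul_apply, List.map_singleton,
      List.prod_singleton, gapOp_single, map_add, map_add, map_smul, map_smul, ih, ih, mul_concat,
      rightD_rightShift, comp_leftDilate_concat, rightD_rightShift, rightShift_nil,
      rightShift_apply, List.nil_append, List.cons_append, smul_eq_mul, mul_comm (G q)]

theorem condPos_condSeries {R M : NCSeries d} (hR : R [] = 0) (hM : M [] = 0) (hMa : adj M = M)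
    (hRpos : CondPos R) (hMpos : (hankel (1 + M)).PosSemidef) : CondPos (condSeries R M) := by
  have hGa : adj (1 + M) = 1 + M := by rw [adj_add, adj_one, hMa]
  refine posSemidef_of_symmetric (kernelForm_isPosSemidef (posSemidef_gapKernel hMpos hRpos))
    (kernelForm_gapOp_symm R hGa) (v := fun j => Finsupp.single ([], [], j) 1) ?_
  rintro ⟨s, i⟩ ⟨t, j⟩
  have h_eval (q u : List (Fin d)) (k : Fin d) :
      kernelForm (gapKernel R (1 + M)) (Finsupp.single ([], [], i) 1)
        (Finsupp.single (q, u, k) 1) = leftD i R (u ++ [k]) * (1 + M) q := by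
    simp [gapKernel, hankel_apply, condHankel_apply, leftD_apply, mul_comm]
  rw [apply_prod_map_gapOp_single h_eval, condHankel_apply,
    condSeries_cons hR hM, comp_leftDilate_concat, rightShift_nil]
  rfl

end NCSeries

namespace Functional

open NCSeries
open scoped ComplexOrder

variable {d : ℕ}

/-- The polynomial with given coefficients. -/
noncomputable def toPoly : (List (Fin d) →₀ ℂ) →ₗ[ℂ] NCPoly d :=
  Finsupp.linearCombination ℂ NCPoly.mon

theorem toPoly_surjective :
    Function.Surjective (toPoly : (List (Fin d) →₀ ℂ) →ₗ[ℂ] NCPoly d) := by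
  intro p
  induction p using MonoidAlgebra.induction_linear with
  | zero => exact ⟨0, map_zero _⟩
  | add p q hp hq =>
    obtain ⟨x, rfl⟩ := hp
    obtain ⟨y, rfl⟩ := hq
    exact ⟨x + y, map_add _ _ _⟩
  | single u c => exact ⟨Finsupp.single u.toList c, by simp [toPoly, NCPoly.mon]⟩

theorem apply_adj_mul (φ : Functional d) (x y : List (Fin d) →₀ ℂ) :
    φ ((toPoly x).adj * toPoly y) = kernelForm (hankel (1 + φ.M)) x y := by
  induction x using Finsupp.induction_linear with
  | zero => simp [NCPoly.adj]
  | add x x' hx hx' => simp only [map_add, NCPoly.adj_add, add_mul, hx, hx', LinearMap.add_apply]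
  | single a r =>
    induction y using Finsupp.induction_linear with
    | zero => simp
    | add y y' hy hy' => simp only [map_add, mul_add, hy, hy']
    | single b s =>
      have h_mon : (toPoly (Finsupp.single a r)).adj * toPoly (Finsupp.single b s) =
          (conj r * s) • NCPoly.mon (a.reverse ++ b) := by
        simp [toPoly, NCPoly.mon, NCPoly.adj_single, MonoidAlgebra.single_mul_single]
      rw [h_mon, map_smul, apply_mon, kernelForm_single, hankel_apply, smul_eq_mul,
        starRingEnd_apply]
      ring

theorem isState_iff_posSemidef (φ : Functional d) :
    φ.IsState ↔ (hankel (1 + φ.M)).PosSemidef := by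
  have h_nonneg : ∀ z : ℂ, (0 ≤ z.re ∧ z.im = 0) ↔ 0 ≤ z := fun z => by
    rw [Complex.nonneg_iff, eq_comm (a := z.im)]
  simp only [IsState, h_nonneg]
  constructor
  · intro h
    refine ⟨isHermitian_hankel (by rw [NCSeries.adj_add, NCSeries.adj_one, φ.adj_M]), fun x => ?_⟩
    have hx := h (toPoly x)
    rwa [apply_adj_mul, kernelForm_apply] at hx
  · intro h p
    obtain ⟨x, rfl⟩ := toPoly_surjective p
    rw [apply_adj_mul]
    exact (kernelForm_isPosSemidef h).nonneg x

theorem isState_iff_condPos_eta (φ : Functional d) : φ.IsState ↔ φ.eta.CondPos :=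
  φ.isState_iff_posSemidef.trans (posSemidef_hankel_iff_condPos_etaOf φ.M_nil φ.adj_M)

theorem isState_Phi {ρ ψ : Functional d} (hρ : ρ.R.CondPos) (hψ : ψ.IsState) :
    (Phi ρ ψ).IsState := by
  rw [isState_iff_condPos_eta, eta_Phi]
  exact condPos_condSeries ρ.R_nil ψ.M_nil ψ.adj_M hρ (ψ.isState_iff_posSemidef.1 hψ)

end Functional

/-! ### Coefficientwise limits -/

namespace NCSeries

open Filter Topology

variable {d : ℕ}

/-- The topology of coefficientwise convergence. -/
noncomputable instance instTopologicalSpace : TopologicalSpace (NCSeries d) :=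
  inferInstanceAs (TopologicalSpace (List (Fin d) → ℂ))

theorem continuous_eval (u : List (Fin d)) : Continuous fun F : NCSeries d => F u :=
  continuous_apply u

theorem continuous_iff {T : Type*} [TopologicalSpace T] {f : T → NCSeries d} :
    Continuous f ↔ ∀ u, Continuous fun t => f t u :=
  continuous_pi_iff

theorem tendsto_iff {ι : Type*} {l : Filter ι} {F : ι → NCSeries d} {G : NCSeries d} :
    Tendsto F l (𝓝 G) ↔ ∀ u, Tendsto (fun t => F t u) l (𝓝 (G u)) :=
  tendsto_pi_nhds

theorem tendsto_of_agreeTo {F : ℕ → NCSeries d} {G : NCSeries d} (h : ∀ n, AgreeTo n (F n) G) :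
    Tendsto F atTop (𝓝 G) := by
  refine tendsto_iff.2 fun u => tendsto_const_nhds.congr' ?_
  filter_upwards [eventually_gt_atTop u.length] with n hn using (h n u hn).symm

instance instIsTopologicalRing : IsTopologicalRing (NCSeries d) where
  continuous_add := continuous_iff.2 fun u =>
    ((continuous_eval u).comp continuous_fst).add ((continuous_eval u).comp continuous_snd)
  continuous_mul := continuous_iff.2 fun u => by
    simp only [mul_apply]
    exact continuous_finsetSum _ fun k _ =>
      ((continuous_eval _).comp continuous_fst).mul ((continuous_eval _).comp continuous_snd)
  continuous_neg := continuous_iff.2 fun u => (continuous_eval u).neg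

instance instContinuousSMul : ContinuousSMul ℂ (NCSeries d) where
  continuous_smul := continuous_iff.2 fun u =>
    continuous_fst.mul ((continuous_eval u).comp continuous_snd)

section Continuity

variable {T : Type*} [TopologicalSpace T] {f g : T → NCSeries d}

theorem continuous_inv (hf : Continuous f) : Continuous fun t => inv (f t) :=
  continuous_iff.2 fun u => continuous_finsetSum _ fun k _ =>
    (continuous_eval u).comp ((continuous_const.sub hf).pow k)

theorem continuous_comp {h : T → Fin d → NCSeries d} (hf : Continuous f) (hh : Continuous h) :
    Continuous fun t => comp (f t) (h t) := by
  refine continuous_iff.2 fun u => continuous_finsetSum _ fun k _ => continuous_finsetSum _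
    fun v _ => ((continuous_eval _).comp hf).mul ((continuous_eval u).comp ?_)
  simp only [← List.map_ofFn (f := v) (g := _), ← Function.comp_def (h _) v]
  exact continuous_list_prod _ fun i _ => (continuous_apply i).comp hh

theorem continuous_leftDilate (hg : Continuous g) : Continuous fun t => leftDilate (g t) :=
  continuous_pi fun _ => hg.mul continuous_const

theorem continuous_momentOfEta (hf : Continuous f) : Continuous fun t => momentOfEta (f t) :=
  (continuous_inv (continuous_const.sub hf)).sub continuous_const

theorem continuous_momentOfFree (hf : Continuous f) : Continuous fun t => momentOfFree (f t) := by
  have h_iterate (n : ℕ) :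
      Continuous fun t => (fun M => comp (f t) (leftDilate (1 + M)))^[n] 0 := by
    induction n with
    | zero => exact continuous_const
    | succ n ih =>
      simp only [Function.iterate_succ_apply']
      exact continuous_comp hf (continuous_leftDilate (continuous_const.add ih))
  exact continuous_iff.2 fun u => ((continuous_eval u).comp (h_iterate (u.length + 1)) :)

theorem continuous_condSeries (hf : Continuous f) (hg : Continuous g) :
    Continuous fun t => condSeries (f t) (g t) :=
  have h := continuous_const.add hg
  (continuous_inv h).mul (continuous_comp hf (continuous_leftDilate h))

end Continuity

theorem condPos_of_tendsto {ι : Type*} {l : Filter ι} [l.NeBot] {F : ι → NCSeries d}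
    {G : NCSeries d} (hF : ∀ᶠ t in l, (F t).CondPos) (h : Tendsto F l (𝓝 G)) : G.CondPos :=
  posSemidef_of_tendsto hF fun _ _ => tendsto_iff.1 h _

end NCSeries

/-! ### Free and Boolean powers -/

namespace NCSeries

variable {d : ℕ}

theorem condSeries_smul (c : ℂ) (R M : NCSeries d) :
    condSeries (c • R) M = c • condSeries R M := by
  rw [condSeries, smul_comp, NCSeries.mul_smul', condSeries]

theorem condSeries_zero_right (R : NCSeries d) : condSeries R 0 = R := by
  rw [condSeries, add_zero, comp_leftDilate_one, inv_eq_of_mul_eq_one rfl (one_mul 1), one_mul]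

theorem momentOfFree_zero : momentOfFree (0 : NCSeries d) = 0 := by
  rw [← momentOfFree_spec, zero_comp]

theorem condSeries_injective_left {M : NCSeries d} (hM : M [] = 0) :
    Function.Injective fun R : NCSeries d => condSeries R M := by
  intro R R' h
  have h_mul := congrArg (fun F => (1 + M) * F) h
  simp only [condSeries, ← mul_assoc, mul_inv _ (one_add_nil hM), one_mul] at h_mul
  exact comp_leftDilate_injective (one_add_nil hM) h_mul

end NCSeries

namespace Functional

open NCSeries Filter Topology
open scoped ComplexOrder

variable {d : ℕ}

theorem M_freePow (ρ : Functional d) (t : ℝ) :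
    (ρ.freePow t).M = momentOfFree ((t : ℂ) • ρ.R) := by
  rw [freePow, ofR, M_ofM]

theorem R_freePow (ρ : Functional d) (t : ℝ) : (ρ.freePow t).R = (t : ℂ) • ρ.R := R_ofR _ _ _

theorem freePow_one (ρ : Functional d) : ρ.freePow 1 = ρ :=
  ext_R (by rw [R_freePow, Complex.ofReal_one, one_smul])

theorem R_freeConv (φ ψ : Functional d) : (freeConv φ ψ).R = φ.R + ψ.R := R_ofR _ _ _

theorem eta_boolConv (φ ψ : Functional d) : (boolConv φ ψ).eta = φ.eta + ψ.eta := eta_ofEta _ _ _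

theorem eta_boolPow (φ : Functional d) (t : ℝ) : (boolPow φ t).eta = (t : ℂ) • φ.eta :=
  eta_ofEta _ _ _

theorem M_eq_momentOfEta (φ : Functional d) : φ.M = momentOfEta φ.eta :=
  (momentOfEta_etaOf φ.M φ.M_nil).symm

theorem eta_Phi_eq_condSeries (ρ ψ : Functional d) : (Phi ρ ψ).eta = condSeries ρ.R ψ.M :=
  eta_Phi ρ ψ

theorem eta_eq_condSeries (φ : Functional d) : φ.eta = condSeries φ.R φ.M := by
  have h := congrArg (fun F => inv (1 + φ.M) * F) (mul_etaOf φ.M_nil)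
  simp only [← mul_assoc, inv_mul _ (one_add_nil φ.M_nil), one_mul] at h
  rw [condSeries, R_spec, ← h, eta]

theorem Phi_self (ρ : Functional d) : Phi ρ ρ = ρ :=
  ext_eta (by rw [eta_Phi_eq_condSeries, ← eta_eq_condSeries])

theorem eta_freePow (ρ : Functional d) (t : ℝ) :
    (ρ.freePow t).eta = (t : ℂ) • condSeries ρ.R (momentOfFree ((t : ℂ) • ρ.R)) := by
  rw [eta_eq_condSeries, R_freePow, M_freePow, condSeries_smul]

theorem tendsto_eta_freePow_div (ρ : Functional d) :
    Tendsto (fun t : ℝ => ((t⁻¹ : ℝ) : ℂ) • (ρ.freePow t).eta) (𝓝[≠] 0) (𝓝 ρ.R) := by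
  have h_cont : Continuous fun t : ℝ => condSeries ρ.R (momentOfFree ((t : ℂ) • ρ.R)) :=
    continuous_condSeries continuous_const
      (continuous_momentOfFree (Complex.continuous_ofReal.smul continuous_const))
  have h_lim := h_cont.tendsto 0
  rw [Complex.ofReal_zero, zero_smul, momentOfFree_zero, condSeries_zero_right] at h_lim
  refine (h_lim.mono_left nhdsWithin_le_nhds).congr' ?_
  filter_upwards [self_mem_nhdsWithin] with t ht
  rw [eta_freePow, smul_smul, ← Complex.ofReal_mul, inv_mul_cancel₀ ht, Complex.ofReal_one,
    one_smul]

theorem tendsto_apply {ι : Type*} {l : Filter ι} {φ : ι → Functional d} {ψ : Functional d}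
    (h : Tendsto (fun t => (φ t).eta) l (𝓝 ψ.eta)) (p : NCPoly d) :
    Tendsto (fun t => φ t p) l (𝓝 (ψ p)) := by
  have hM : Tendsto (fun t => 1 + (φ t).M) l (𝓝 (1 + ψ.M)) := by
    simp only [M_eq_momentOfEta]
    exact tendsto_const_nhds.add (((continuous_momentOfEta continuous_id).tendsto _).comp h)
  induction p using MonoidAlgebra.induction_linear with
  | zero => simpa only [map_zero] using tendsto_const_nhds
  | add p q hp hq => simpa only [map_add] using hp.add hq
  | single u c =>
    have h_single : (MonoidAlgebra.single u c : NCPoly d) = c • NCPoly.mon u.toList := by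
      simp [NCPoly.mon]
    simp only [h_single, map_smul, apply_mon, smul_eq_mul]
    exact (tendsto_iff.1 hM _).const_mul c

theorem IsFreelyInfDiv.condPos {ρ : Functional d} (h : ρ.IsFreelyInfDiv) : ρ.R.CondPos := by
  have h_lim := ρ.tendsto_eta_freePow_div.mono_left
    (nhdsWithin_mono 0 fun _ ht => ne_of_gt (Set.mem_Ioi.1 ht))
  refine condPos_of_tendsto ?_ h_lim
  filter_upwards [self_mem_nhdsWithin] with t ht
  exact ((isState_iff_condPos_eta _).1 (h t (le_of_lt ht))).smul (inv_nonneg.2 (le_of_lt ht))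

/-! ### Point masses -/

/-- The linear series `∑ i, a i w_i`, the Boolean and free cumulant series of `delta a`. -/
noncomputable def linSeries (a : Fin d → ℝ) : NCSeries d := ∑ i, (a i : ℂ) • X i

theorem linSeries_nil (a : Fin d → ℝ) : linSeries a [] = 0 := by
  simp [linSeries, NCSeries.sum_apply, NCSeries.smul_apply, X_nil, -Complex.coe_smul]

theorem linSeries_mul_cons (a : Fin d → ℝ) (F : NCSeries d) (i : Fin d) (u : List (Fin d)) :
    (linSeries a * F) (i :: u) = a i * F u := by
  simp only [linSeries, sum_mul, NCSeries.smul_mul', ← NCSeries.mul_smul', sum_X_mul_cons,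
    NCSeries.smul_apply]

theorem linSeries_cons (a : Fin d → ℝ) (i : Fin d) (u : List (Fin d)) :
    linSeries a (i :: u) = if u = [] then (a i : ℂ) else 0 := by
  rw [← mul_one (linSeries a), linSeries_mul_cons, one_apply, mul_ite, mul_one, mul_zero]

theorem linSeries_of_two_le (a : Fin d → ℝ) {u : List (Fin d)} (hu : 2 ≤ u.length) :
    linSeries a u = 0 := by
  match u with
  | i :: j :: u => rw [linSeries_cons, if_neg (List.cons_ne_nil j u)]

theorem linSeries_neg (a : Fin d → ℝ) : linSeries (-a) = -linSeries a := by
  simp [linSeries, -Complex.coe_smul]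

theorem linSeries_comp_leftDilate (a : Fin d → ℝ) (G : NCSeries d) :
    comp (linSeries a) (leftDilate G) = G * linSeries a := by
  simp only [linSeries, sum_comp, smul_comp, X_comp _ (leftDilate_nil G), leftDilate, mul_sum,
    NCSeries.mul_smul']

theorem M_delta (a : Fin d → ℝ) : (delta a).M = deltaSeries a := M_ofM _ _ _

theorem M_delta_zero : (delta (0 : Fin d → ℝ)).M = 0 := by
  rw [M_delta]
  ext u
  cases u <;> simp [deltaSeries, NCSeries.zero_apply]

theorem one_add_M_delta_apply (a : Fin d → ℝ) (u : List (Fin d)) :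
    (1 + (delta a).M) u = ((u.map a).prod : ℝ) := by
  rw [M_delta, NCSeries.add_apply, one_apply, deltaSeries]
  by_cases h : u = [] <;> simp [h]

theorem M_delta_eq_momentOfEta (a : Fin d → ℝ) : (delta a).M = momentOfEta (linSeries a) := by
  have h_mul : (1 - linSeries a) * (1 + (delta a).M) = 1 := by
    rw [sub_mul, one_mul, sub_eq_iff_eq_add]
    ext u
    cases u with
    | nil => simp [NCSeries.add_apply, mul_nil, linSeries_nil, M_nil]
    | cons i u =>
      rw [NCSeries.add_apply (1 : NCSeries d) (_ * _), linSeries_mul_cons, one_add_M_delta_apply,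
        one_add_M_delta_apply, one_apply]
      simp
  have h_nil : (1 - linSeries a) [] = 1 := by
    rw [NCSeries.sub_apply, linSeries_nil, sub_zero, one_apply, if_pos rfl]
  rw [momentOfEta, inv_eq_of_mul_eq_one h_nil h_mul, add_sub_cancel_left]

theorem eta_delta (a : Fin d → ℝ) : (delta a).eta = linSeries a := by
  rw [eta, M_delta_eq_momentOfEta, etaOf_momentOfEta _ (linSeries_nil a)]

theorem R_delta (a : Fin d → ℝ) : (delta a).R = linSeries a := by
  refine (freeOf_unique _ _ (M_nil _) ?_).symm
  rw [linSeries_comp_leftDilate, ← eta_delta, eta, mul_etaOf (M_nil _)]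

theorem isState_delta (a : Fin d → ℝ) : (delta a).IsState := by
  have h_zero : condHankel (linSeries a) = 0 := by
    ext u v
    exact linSeries_of_two_le a (by simp only [List.length_append, List.length_cons]; omega)
  rw [isState_iff_condPos_eta, eta_delta, CondPos, h_zero]
  exact Matrix.PosSemidef.zero

theorem Phi_delta_left (a : Fin d → ℝ) (ψ : Functional d) : Phi (delta a) ψ = delta a := by
  apply ext_eta
  rw [eta_Phi_eq_condSeries, condSeries, R_delta, linSeries_comp_leftDilate, eta_delta,
    ← mul_assoc, inv_mul _ (one_add_nil ψ.M_nil), one_mul]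

theorem eq_delta_of_R_eq_zero {ρ : Functional d} (h : ∀ u, 2 ≤ u.length → ρ.R u = 0) :
    ρ = delta fun i => (ρ.R [i]).re := by
  refine ext_R (NCSeries.ext fun u => ?_)
  rw [R_delta]
  match u with
  | [] => rw [linSeries_nil, R_nil]
  | [i] =>
    rw [linSeries_cons, if_pos rfl]
    exact (Complex.conj_eq_iff_re.1 (conj_apply_of_adj_eq ρ.adj_R [i])).symm
  | i :: j :: u => rw [h _ (by simp), linSeries_of_two_le _ (by simp)]

/-! ### Free infinite divisibility -/

theorem M_agreeTo_of_eta_agreeTo {φ ψ : Functional d} {n : ℕ} (h : AgreeTo n φ.eta ψ.eta) :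
    AgreeTo n φ.M ψ.M := by
  have h_pow (k : ℕ) : AgreeTo n (φ.eta ^ k) (ψ.eta ^ k) := by
    induction k with
    | zero => exact AgreeTo.refl _ _
    | succ k ih => simpa only [pow_succ] using ih.mul h
  intro u hu
  simp only [M_eq_momentOfEta, momentOfEta, inv, NCSeries.sub_apply, sub_sub_cancel]
  exact congrArg (· - _) (sum_congr rfl fun k _ => h_pow k u hu)

theorem eta_Phi_agreeTo (ρ : Functional d) {ψ ψ' : Functional d} {n : ℕ}
    (h : AgreeTo n ψ.M ψ'.M) : AgreeTo (n + 1) (Phi ρ ψ).eta (Phi ρ ψ').eta := by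
  intro u hu
  rw [eta_Phi_eq_condSeries, eta_Phi_eq_condSeries]
  cases u with
  | nil => rw [condSeries_nil _ _ ρ.R_nil, condSeries_nil _ _ ρ.R_nil]
  | cons i u =>
    rw [condSeries_cons ρ.R_nil ψ.M_nil, condSeries_cons ρ.R_nil ψ'.M_nil]
    exact contracting_momentOfFree _ n _ _ h u (by simp only [List.length_cons] at hu; omega)

theorem isState_of_condPos_R {ρ : Functional d} (hρ : ρ.R.CondPos) : ρ.IsState := by
  -- `ρ` is the limit of the iterates of the positivity preserving map `Φ[ρ, ·]`.
  have h_state (n : ℕ) : ((Phi ρ)^[n] (delta 0)).IsState := by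
    induction n with
    | zero => exact isState_delta 0
    | succ n ih => rw [Function.iterate_succ_apply']; exact isState_Phi hρ ih
  have h_agree (n : ℕ) : AgreeTo n ((Phi ρ)^[n] (delta 0)).eta ρ.eta := by
    induction n with
    | zero => exact agreeTo_zero _ _
    | succ n ih =>
      have h := eta_Phi_agreeTo ρ (M_agreeTo_of_eta_agreeTo ih)
      rwa [Phi_self, ← Function.iterate_succ_apply' (Phi ρ)] at h
  exact (isState_iff_condPos_eta ρ).2 (condPos_of_tendsto
    (.of_forall fun n => (isState_iff_condPos_eta _).1 (h_state n)) (tendsto_of_agreeTo h_agree))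

theorem isFreelyInfDiv_iff_condPos (ρ : Functional d) : ρ.IsFreelyInfDiv ↔ ρ.R.CondPos :=
  ⟨IsFreelyInfDiv.condPos, fun h t ht => isState_of_condPos_R (by
    rw [R_freePow]
    exact h.smul ht)⟩

/-! ### Mean, covariance and fixed points -/

theorem Phi_injective_left {ρ ρ' ψ : Functional d} (h : Phi ρ ψ = Phi ρ' ψ) : ρ = ρ' := by
  refine ext_R (condSeries_injective_left ψ.M_nil ?_)
  simpa only [eta_Phi_eq_condSeries] using congrArg eta h

theorem Phi_eq_right_iff (ρ ψ : Functional d) : Phi ρ ψ = ψ ↔ ψ = ρ :=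
  ⟨fun h => (Phi_injective_left (h.trans (Phi_self ψ).symm)).symm, fun h => h ▸ Phi_self ψ⟩

theorem eta_singleton (φ : Functional d) (i : Fin d) : φ.eta [i] = φ.R [i] := by
  rw [eta_eq_condSeries, condSeries_singleton φ.R_nil φ.M_nil]

theorem eta_pair (φ : Functional d) (i j : Fin d) : φ.eta [i, j] = φ.R [i, j] := by
  rw [eta_eq_condSeries, condSeries_pair φ.R_nil φ.M_nil]

theorem M_singleton (φ : Functional d) (i : Fin d) : φ.M [i] = φ.eta [i] := by
  conv_lhs => rw [← etaOf_mul φ.M_nil]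
  rw [mul_cons, mul_nil, etaOf_nil, zero_mul, add_zero, one_add_nil φ.M_nil, mul_one]
  rfl

theorem M_pair (φ : Functional d) (i j : Fin d) :
    φ.M [i, j] = φ.eta [i, j] + φ.M [i] * φ.M [j] := by
  conv_lhs => rw [← etaOf_mul φ.M_nil]
  rw [mul_cons, mul_cons, mul_nil, etaOf_nil, zero_mul, add_zero, one_add_nil φ.M_nil, mul_one,
    leftD_apply, one_add_cons, M_singleton, M_singleton]
  rfl

theorem mean_apply (φ : Functional d) (i : Fin d) : φ.mean i = φ.eta [i] := by
  rw [← M_singleton]; simp [mean, M, NCPoly.x]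

theorem cov_apply (φ : Functional d) (i j : Fin d) : φ.cov i j = φ.eta [i, j] := by
  have h := M_pair φ i j
  simp only [M, List.cons_ne_nil, if_false] at h
  rw [cov, Matrix.of_apply, NCPoly.x, NCPoly.x, NCPoly.mon_mul, List.singleton_append, h,
    add_sub_cancel_right]

theorem mean_Phi (ρ ψ : Functional d) : (Phi ρ ψ).mean = ρ.mean := by
  funext i
  rw [mean_apply, mean_apply, eta_Phi_eq_condSeries, condSeries_singleton ρ.R_nil ψ.M_nil,
    eta_singleton]

theorem cov_Phi (ρ ψ : Functional d) : (Phi ρ ψ).cov = ρ.cov := by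
  ext i j
  rw [cov_apply, cov_apply, eta_Phi_eq_condSeries, condSeries_pair ρ.R_nil ψ.M_nil, eta_pair]

end Functional

/-! ### Insertion of a series before the letters of words -/

section Words

variable {α : Type*} [LinearOrder α]

theorem append_lt_append_iff_of_length_eq {a a' b b' : List α} (h : a.length = a'.length) :
    a ++ b < a' ++ b' ↔ a < a' ∨ a = a' ∧ b < b' := by
  induction a generalizing a' with
  | nil =>
    obtain rfl : a' = [] := List.length_eq_zero_iff.1 h.symm
    simp
  | cons x a ih =>
    cases a' with
    | nil => simp at h
    | cons y a' =>
      simp only [List.cons_append, List.cons_lt_cons_iff, ih (Nat.succ.inj h), List.cons.injEq]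
      tauto

theorem append_append_lt_append_append {p p' s s' v v' : List α} (hp : p.length = p'.length)
    (hv : v.length = v'.length) (hu : p ++ s ≤ p' ++ s') (hle : v ≤ v')
    (hne : ¬(p ++ s = p' ++ s' ∧ v = v')) : p ++ (v ++ s) < p' ++ (v' ++ s') := by
  rw [append_lt_append_iff_of_length_eq hp, append_lt_append_iff_of_length_eq hv]
  rcases hu.lt_or_eq with h | h
  · rcases (append_lt_append_iff_of_length_eq hp).1 h with h | ⟨h, h'⟩
    · exact Or.inl h
    · rcases hle.lt_or_eq with h2 | h2
      · exact Or.inr ⟨h, Or.inl h2⟩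
      · exact Or.inr ⟨h, Or.inr ⟨h2, h'⟩⟩
  · obtain ⟨h1, -⟩ := List.append_inj h hp
    exact Or.inr ⟨h1, Or.inl (hle.lt_of_ne fun h_eq => hne ⟨h, h_eq⟩)⟩

theorem exists_maximal_insertion {u : List α} (hu : u ≠ []) (v : List α) :
    ∃ p s, p ++ s = u ∧ s ≠ [] ∧
      ∀ p' s', p' ++ s' = u → s' ≠ [] → p' ++ (v ++ s') ≤ p ++ (v ++ s) := by
  obtain ⟨k, hk, h_max⟩ := exists_max_image (range u.length)
    (fun k => u.take k ++ (v ++ u.drop k)) ⟨0, mem_range.2 (List.length_pos_of_ne_nil hu)⟩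
  refine ⟨_, _, List.take_append_drop k u, ?_, ?_⟩
  · simpa using hk
  · rintro p' s' rfl hs'
    have h := h_max p'.length (by simpa using List.length_pos_of_ne_nil hs')
    rwa [List.take_left, List.drop_left] at h

theorem eq_of_append_append_eq_maximal_insertion {p s v p' s' v' : List α}
    (h_max : ∀ q t, q ++ t = p ++ s → t ≠ [] → q ++ (v ++ t) ≤ p ++ (v ++ s))
    (hW : p' ++ (v' ++ s') = p ++ (v ++ s)) (hs' : s' ≠ []) (h_len : v'.length = v.length)
    (hv : v' ≤ v) (hu : p' ++ s' ≤ p ++ s) : p' ++ s' = p ++ s ∧ v' = v := by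
  by_contra hne
  have hW_len := congrArg List.length hW
  have hs'_pos := List.length_pos_of_ne_nil hs'
  simp only [List.length_append] at hW_len
  have h_lt := append_append_lt_append_append (p := p') (s := s') (v := v')
    (p' := (p ++ s).take p'.length) (s' := (p ++ s).drop p'.length) (v' := v)
    (by simp only [List.length_take, List.length_append]; omega) h_len
    (by rwa [List.take_append_drop]) hv (by rwa [List.take_append_drop])
  rw [hW] at h_lt
  refine h_lt.not_ge (h_max _ _ (List.take_append_drop _ _) ?_)
  rw [← List.length_pos_iff, List.length_drop, List.length_append]
  omega

theorem sum_ne_zero_of_eq_zero_or_eq {ι M : Type*} [AddCommMonoid M] [IsAddTorsionFree M]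
    {s : Finset ι} {f : ι → M} {c : M} (hc : c ≠ 0) (hf : ∀ i ∈ s, f i = 0 ∨ f i = c)
    (h : ∃ i ∈ s, f i = c) : ∑ i ∈ s, f i ≠ 0 := by
  classical
  obtain ⟨i, hi, hfi⟩ := h
  have h_const : ∀ j ∈ s.filter (f · ≠ 0), f j = c := fun j hj =>
    (hf j (mem_filter.1 hj).1).resolve_left (mem_filter.1 hj).2
  rw [← sum_filter_ne_zero, sum_congr rfl h_const, sum_const]
  exact (nsmul_right_injective (card_ne_zero_of_mem (mem_filter.2 ⟨hi, hfi ▸ hc⟩))).ne_iff'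
    (nsmul_zero _) |>.2 hc

end Words

namespace NCSeries

variable {d : ℕ}

theorem AgreeTo.sub_iff {n : ℕ} {F G : NCSeries d} : AgreeTo n (F - G) 0 ↔ AgreeTo n F G :=
  forall₂_congr fun _ _ => sub_eq_zero

theorem agreeTo_zero_mul {n m : ℕ} {F G : NCSeries d} (hF : AgreeTo n F 0)
    (hG : AgreeTo m G 0) : AgreeTo (n + m) (F * G) 0 := by
  intro u hu
  rw [mul_apply]
  refine sum_eq_zero fun k hk => ?_
  rw [mem_range] at hk
  rcases Nat.lt_or_ge k n with hlt | hge
  · rw [hF _ (by rw [List.length_take]; omega), zero_apply, zero_mul]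
  · rw [hG _ (by rw [List.length_drop]; omega), zero_apply, mul_zero]

theorem AgreeTo.rightD {n : ℕ} {F : NCSeries d} (hF : AgreeTo (n + 1) F 0) (j : Fin d) :
    AgreeTo n (rightD j F) 0 :=
  fun u hu => hF _ (by simpa using hu)

theorem exists_order {F : NCSeries d} (hF : F ≠ 0) :
    ∃ n, AgreeTo n F 0 ∧ ∃ u : List (Fin d), u.length = n ∧ F u ≠ 0 := by
  classical
  have h_ex : ∃ n, ∃ u : List (Fin d), u.length = n ∧ F u ≠ 0 := by
    by_contra! h
    exact hF (NCSeries.ext fun u => h _ u rfl)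
  refine ⟨Nat.find h_ex, fun u hu => ?_, Nat.find_spec h_ex⟩
  by_contra hne
  exact Nat.find_min h_ex hu ⟨u, rfl, hne⟩

theorem exists_maximal_word {F : NCSeries d} {n : ℕ} (hF : ∃ u, u.length = n ∧ F u ≠ 0) :
    ∃ u : List (Fin d), u.length = n ∧ F u ≠ 0 ∧ ∀ v, v.length = n → F v ≠ 0 → v ≤ u := by
  obtain ⟨u, hu, h_max⟩ := Set.exists_max_image {u : List (Fin d) | u.length = n ∧ F u ≠ 0} id
    ((List.finite_length_eq (Fin d) n).subset fun u hu => hu.1) hF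
  exact ⟨u, hu.1, hu.2, fun v hv hv' => h_max v ⟨hv, hv'⟩⟩

/-- The insertion of `Q` before each letter of the words of `P`, that is, the image of `P` under
the derivation with `w_i ↦ Q w_i`. The sum runs over the positions of a word at which the
inserted block may end. -/
noncomputable def insertion (Q P : NCSeries d) : NCSeries d := fun W =>
  ∑ k ∈ range W.length, (rightShift (W.drop k) P * Q) (W.take k)

theorem insertion_concat (Q P : NCSeries d) (u : List (Fin d)) (j : Fin d) :
    insertion Q P (u ++ [j]) = insertion Q (rightD j P) u + (rightD j P * Q) u := by
  rw [insertion, List.length_append, List.length_singleton, sum_range_succ, List.take_left,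
    List.drop_left, insertion]
  refine congrArg₂ _ (sum_congr rfl fun k hk => ?_) rfl
  rw [mem_range] at hk
  rw [List.drop_append_of_le_length hk.le, List.take_append_of_le_length hk.le]
  have h_shift : rightShift (u.drop k ++ [j]) P = rightShift (u.drop k) (rightD j P) := by
    ext w
    simp only [rightShift_apply, rightD_apply, List.append_assoc]
  rw [h_shift]

theorem insertion_apply (Q P : NCSeries d) (W : List (Fin d)) :
    insertion Q P W = ∑ x ∈ (range W.length).sigma fun k => range (k + 1),
      P ((W.take x.1).take x.2 ++ W.drop x.1) * Q ((W.take x.1).drop x.2) := by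
  rw [sum_sigma, insertion]
  refine sum_congr rfl fun k hk => ?_
  rw [mul_apply, List.length_take, min_eq_left (mem_range.1 hk).le]
  rfl

theorem insertion_agreeTo_zero {P Q : NCSeries d} {n m : ℕ}
    (hP : ∀ u ≠ [], u.length < n → P u = 0) (hQ : AgreeTo m Q 0) :
    AgreeTo (n + m) (insertion Q P) 0 := by
  intro W hW
  rw [insertion_apply]
  refine sum_eq_zero ?_
  rintro ⟨k, l⟩ hkl
  simp only [mem_sigma, mem_range] at hkl ⊢
  rcases Nat.lt_or_ge (k - l) m with hlt | hge
  · rw [hQ ((W.take k).drop l) (by simp only [List.length_drop, List.length_take]; omega),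
      zero_apply, mul_zero]
  · have h_len : ((W.take k).take l ++ W.drop k).length = l + (W.length - k) := by
      simp only [List.length_append, List.length_take, List.length_drop]
      omega
    rw [hP _ (by rw [ne_eq, ← List.length_eq_zero_iff]; omega) (by omega), zero_mul]

/-- Of all words obtained by inserting the greatest word of `Q` into the greatest word of `P`, the
greatest one cannot arise from any other words, so its coefficient is a positive multiple of the
product of the two leading coefficients. -/
theorem exists_insertion_ne_zero {P Q : NCSeries d} {n m : ℕ} (hn : 1 ≤ n) (hP : AgreeTo n P 0)
    (hQ : AgreeTo m Q 0) (hP' : ∃ u, u.length = n ∧ P u ≠ 0)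
    (hQ' : ∃ v, v.length = m ∧ Q v ≠ 0) :
    ∃ W : List (Fin d), W.length = n + m ∧ insertion Q P W ≠ 0 := by
  obtain ⟨u, hu_len, hu, hu_max⟩ := exists_maximal_word hP'
  obtain ⟨v, hv_len, hv, hv_max⟩ := exists_maximal_word hQ'
  obtain ⟨p, s, rfl, hs, hW_max⟩ := exists_maximal_insertion (u := u)
    (by rintro rfl; simp at hu_len; omega) v
  have hW_len : (p ++ (v ++ s)).length = n + m := by
    simp only [List.length_append] at hu_len ⊢
    omega
  have h_unique : ∀ p' v' s', p' ++ (v' ++ s') = p ++ (v ++ s) → s' ≠ [] →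
      P (p' ++ s') * Q v' ≠ 0 → p' ++ s' = p ++ s ∧ v' = v := by
    intro p' v' s' hW hs' hne
    have hP_len := le_of_not_gt (mt (hP (p' ++ s')) (left_ne_zero_of_mul hne))
    have hQ_len := le_of_not_gt (mt (hQ v') (right_ne_zero_of_mul hne))
    have h_len := congrArg List.length hW
    rw [hW_len] at h_len
    simp only [List.length_append] at hP_len h_len hu_len
    exact eq_of_append_append_eq_maximal_insertion hW_max hW hs' (by omega)
      (hv_max _ (by omega) (right_ne_zero_of_mul hne))
      (hu_max _ (by rw [List.length_append]; omega) (left_ne_zero_of_mul hne))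
  refine ⟨p ++ (v ++ s), hW_len, ?_⟩
  rw [insertion_apply]
  refine sum_ne_zero_of_eq_zero_or_eq (c := P (p ++ s) * Q v) (mul_ne_zero hu hv) ?_ ?_
  · rintro ⟨k, l⟩ hkl
    rw [mem_sigma, mem_range] at hkl
    refine or_iff_not_imp_left.2 fun hne => ?_
    obtain ⟨h_outer, h_inner⟩ := h_unique _ _ _
      (by rw [← List.append_assoc, List.take_append_drop, List.take_append_drop])
      (by simpa using hkl.1) hne
    rw [h_outer, h_inner]
  · have hs_pos := List.length_pos_of_ne_nil hs
    refine ⟨⟨(p ++ v).length, p.length⟩, ?_, ?_⟩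
    · simp only [mem_sigma, mem_range, List.length_append]
      omega
    · rw [← List.append_assoc, List.take_left, List.drop_left, List.take_left, List.drop_left]

theorem comp_leftDilate_sub_self_agreeTo_zero {F G : NCSeries d} (hG : G [] = 1) {n : ℕ}
    (hF : AgreeTo n F 0) : AgreeTo (n + 1) (comp F (leftDilate G) - F) 0 := by
  intro u hu
  rw [sub_apply, comp_leftDilate_apply F G hG, add_sub_cancel_right]
  refine sum_eq_zero fun k hk => sum_eq_zero fun v _ => ?_
  rw [mem_range] at hk
  rw [hF _ (by rw [List.length_ofFn]; omega), zero_apply, zero_mul]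

theorem comp_leftDilate_sub_comp_agreeTo_insertion {F G G' : NCSeries d} (hG : G [] = 1)
    (hG' : G' [] = 1) {n m : ℕ} (hF : AgreeTo n F 0) (hQ : AgreeTo m (G - G') 0) :
    AgreeTo (n + m + 1) (comp F (leftDilate G) - comp F (leftDilate G'))
      (insertion (G - G') F) := by
  induction n generalizing F with
  | zero =>
    intro W hW
    rw [sub_apply, comp_agreeTo F (n := m + 1) (H := leftDilate G) (H' := leftDilate G')
        (fun i => (AgreeTo.sub_iff.1 hQ).mul_X i) W (by omega), sub_self,
      insertion_agreeTo_zero (n := 1) (fun u hu h => (hu (by simpa using h)).elim) hQ W (by omega),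
      zero_apply]
  | succ n ih =>
    intro W hW
    rcases W.eq_nil_or_concat with rfl | ⟨u, j, rfl⟩
    · rw [sub_apply, comp_nil, comp_nil, sub_self, insertion, List.length_nil, range_zero,
        sum_empty]
    · set D := rightD j F
      set Δ := comp D (leftDilate G) - comp D (leftDilate G') with hΔ
      have hu : u.length < n + m + 1 := by
        rw [List.concat_eq_append, List.length_append, List.length_singleton] at hW
        omega
      have hD : AgreeTo n D 0 := hF.rightD j
      have hG_sub : AgreeTo 1 (G - 1) 0 := by
        intro w hw
        rw [List.length_eq_zero_iff.1 (by omega : w.length = 0), sub_apply, hG, one_apply,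
          if_pos rfl, sub_self, zero_apply]
      have hΔ_insertion : AgreeTo (n + m + 1) Δ (insertion (G - G') D) := ih hD
      have hΔ_zero : AgreeTo (n + m) Δ 0 := fun w hw =>
        (hΔ_insertion w (by omega)).trans (insertion_agreeTo_zero (fun w _ => hD w) hQ w hw)
      have h_expand : comp D (leftDilate G) * G - comp D (leftDilate G') * G' =
          Δ + D * (G - G') + Δ * (G - 1) + (comp D (leftDilate G') - D) * (G - G') := by
        rw [hΔ]
        noncomm_ring
      rw [List.concat_eq_append, sub_apply, comp_leftDilate_concat, comp_leftDilate_concat,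
        ← sub_apply, h_expand, add_apply, add_apply, add_apply, insertion_concat,
        hΔ_insertion u hu,
        agreeTo_zero_mul hΔ_zero hG_sub u hu,
        agreeTo_zero_mul (comp_leftDilate_sub_self_agreeTo_zero hG' hD) hQ u (by omega),
        zero_apply, add_zero, add_zero]

theorem comp_leftDilate_injective_right {F G G' : NCSeries d} (hF : ∃ u ≠ [], F u ≠ 0)
    (hG : G [] = 1) (hG' : G' [] = 1)
    (h : comp F (leftDilate G) = comp F (leftDilate G')) : G = G' := by
  by_contra hne
  obtain ⟨u, hu, hFu⟩ := hF
  set F₀ := F - F [] • 1 with hF₀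
  have hF₀_nil : F₀ [] = 0 := by
    rw [hF₀, sub_apply, smul_apply, one_apply, if_pos rfl, mul_one, sub_self]
  have hF₀_ne : F₀ ≠ 0 := fun h0 => hFu <| by
    simpa [hF₀, sub_apply, smul_apply, one_apply, zero_apply, hu] using congrFun h0 u
  obtain ⟨n, hn, hn'⟩ := exists_order hF₀_ne
  obtain ⟨m, hm, hm'⟩ := exists_order (sub_ne_zero.2 hne)
  have hn_pos : 1 ≤ n := by
    obtain ⟨w, rfl, hw⟩ := hn'
    exact List.length_pos_of_ne_nil fun h_nil => hw (h_nil ▸ hF₀_nil)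
  obtain ⟨W, hW, hW_ne⟩ := exists_insertion_ne_zero hn_pos hn hm hn' hm'
  refine hW_ne ?_
  rw [← comp_leftDilate_sub_comp_agreeTo_insertion hG hG' hn hm W (by omega), hF₀, sub_comp,
    sub_comp, h, smul_comp, smul_comp, one_comp (leftDilate_nil _), one_comp (leftDilate_nil _),
    sub_self, zero_apply]

theorem condSeries_injective_right {R M M' : NCSeries d} (hR : R [] = 0) (hM : M [] = 0)
    (hM' : M' [] = 0) (hR2 : ∃ u, 2 ≤ u.length ∧ R u ≠ 0)
    (h : condSeries R M = condSeries R M') : M = M' := by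
  obtain ⟨u, hu_len, hu⟩ := hR2
  obtain ⟨i, u', rfl⟩ := List.exists_cons_of_length_pos (l := u) (by omega)
  refine add_left_cancel (comp_leftDilate_injective_right (F := leftD i R)
    ⟨u', ?_, hu⟩ (one_add_nil hM) (one_add_nil hM') ?_)
  · rintro rfl
    simp at hu_len
  · ext w
    rw [← condSeries_cons hR hM, ← condSeries_cons hR hM', h]

end NCSeries

namespace Functional

open NCSeries

variable {d : ℕ}

theorem Phi_injective_right {ρ ψ ψ' : Functional d} (hρ : ∀ a : Fin d → ℝ, ρ ≠ delta a)
    (h : Phi ρ ψ = Phi ρ ψ') : ψ = ψ' := by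
  refine ext_M (condSeries_injective_right ρ.R_nil ψ.M_nil ψ'.M_nil ?_
    (by rw [← eta_Phi_eq_condSeries, h, eta_Phi_eq_condSeries]))
  by_contra! hR
  exact hρ _ (eq_delta_of_R_eq_zero hR)

theorem Phi_eq_left_iff (ρ σ : Functional d) :
    Phi σ ρ = σ ↔ σ = ρ ∨ ∃ a : Fin d → ℝ, σ = delta a := by
  constructor
  · intro h
    by_cases! hσ : ∃ a : Fin d → ℝ, σ = delta a
    · exact Or.inr hσ
    · exact Or.inl (Phi_injective_right hσ ((Phi_self σ).trans h.symm))
  · rintro (rfl | ⟨a, rfl⟩)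
    · exact Phi_self σ
    · exact Phi_delta_left a ρ

end Functional

/-! ### Free translations and the Boolean-to-free bijection -/

namespace NCSeries

variable {d : ℕ}

theorem inv_mul_rev {F G : NCSeries d} (hF : F [] = 1) (hG : G [] = 1) :
    inv (F * G) = inv G * inv F := by
  refine inv_eq_of_mul_eq_one (by rw [mul_nil, hF, hG, one_mul]) ?_
  rw [mul_assoc, ← mul_assoc G, mul_inv G hG, one_mul, mul_inv F hF]

theorem comp_momentOfFree_eq_iff {R K N : NCSeries d} :
    comp (momentOfFree R) (leftDilate K) = N ↔ comp R (leftDilate ((1 + N) * K)) = N := by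
  have h_fix : comp R (leftDilate ((1 + comp (momentOfFree R) (leftDilate K)) * K)) =
      comp (momentOfFree R) (leftDilate K) := by
    conv_rhs => rw [← momentOfFree_spec, comp_leftDilate_comp, add_comp,
      one_comp (leftDilate_nil K)]
  have h_contracting : Contracting fun N : NCSeries d => comp R (leftDilate ((1 + N) * K)) := by
    intro n F G h
    have h_one_add : AgreeTo n (1 + F) (1 + G) := fun u hu => by
      rw [NCSeries.add_apply, NCSeries.add_apply, h u hu]
    exact comp_agreeTo R fun i => (h_one_add.mul (AgreeTo.refl n K)).mul_X i
  exact ⟨by rintro rfl; exact h_fix, h_contracting.unique h_fix⟩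

theorem condSeries_condSeries {M M' : NCSeries d} (R : NCSeries d) (hM : M [] = 0)
    (hM' : M' [] = 0) : condSeries (condSeries R M') M =
      condSeries R (comp (1 + M') (leftDilate (1 + M)) * (1 + M) - 1) := by
  simp only [condSeries]
  rw [add_sub_cancel, mul_comp _ _ (leftDilate_nil _),
    inv_comp (one_add_nil hM') (leftDilate_nil _), comp_leftDilate_comp, ← mul_assoc,
    inv_mul_rev (by rw [comp_nil, one_add_nil hM']) (one_add_nil hM)]

end NCSeries

namespace Functional

open NCSeries Filter Topology

variable {d : ℕ}

theorem linSeries_add (a b : Fin d → ℝ) :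
    linSeries (a + b) = linSeries a + linSeries b := by
  ext u
  cases u with
  | nil => simp [linSeries_nil, NCSeries.add_apply]
  | cons i u =>
    rw [NCSeries.add_apply, linSeries_cons, linSeries_cons, linSeries_cons]
    split_ifs <;> simp

theorem inv_one_add_M_delta (a : Fin d → ℝ) : inv (1 + (delta a).M) = 1 - linSeries a := by
  rw [inv_one_add, ← eta, eta_delta]

theorem one_add_M_delta_mul_linSeries (a : Fin d → ℝ) :
    (1 + (delta a).M) * linSeries a = (delta a).M := by
  rw [← eta_delta, eta, mul_etaOf (M_nil _)]

theorem one_add_M_delta_add (a b : Fin d → ℝ) : 1 + (delta (a + b)).M =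
    comp (1 + (delta b).M) (leftDilate (1 + (delta a).M)) * (1 + (delta a).M) := by
  set K := 1 + (delta a).M with hK
  have hK_nil : K [] = 1 := one_add_nil (M_nil _)
  have h_cancel : (1 - K * linSeries b) * comp (1 + (delta b).M) (leftDilate K) = 1 := by
    have h_inv : comp (inv (1 + (delta b).M)) (leftDilate K) = 1 - K * linSeries b := by
      rw [inv_one_add_M_delta, sub_comp, one_comp (leftDilate_nil K), linSeries_comp_leftDilate]
    rw [← h_inv, ← mul_comp _ _ (leftDilate_nil K), inv_mul _ (one_add_nil (M_nil _)),
      one_comp (leftDilate_nil K)]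
  have h_factor : 1 - linSeries (a + b) = inv K * (1 - K * linSeries b) := by
    rw [mul_sub, mul_one, ← mul_assoc, inv_mul K hK_nil, one_mul, hK, inv_one_add_M_delta,
      linSeries_add, sub_sub]
  rw [M_delta_eq_momentOfEta, momentOfEta, add_sub_cancel]
  refine inv_eq_of_mul_eq_one ?_ ?_
  · rw [NCSeries.sub_apply, linSeries_nil, one_apply, if_pos rfl, sub_zero]
  · rw [h_factor, mul_assoc, ← mul_assoc _ _ K, h_cancel, one_mul, inv_mul K hK_nil]

theorem condSeries_condSeries_delta (R : NCSeries d) (a b : Fin d → ℝ) :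
    condSeries (condSeries R (delta b).M) (delta a).M = condSeries R (delta (a + b)).M := by
  rw [condSeries_condSeries R (M_nil _) (M_nil _), ← one_add_M_delta_add, add_sub_cancel_left]

theorem eta_freeConv_delta (σ : Functional d) (a : Fin d → ℝ) :
    (freeConv σ (delta a)).eta + linSeries (-a) = condSeries σ.eta (delta a).M := by
  set K := 1 + (delta a).M with hK
  have hK_nil : K [] = 1 := one_add_nil (M_nil _)
  set N := comp σ.M (leftDilate K) with hN
  have hN_nil : N [] = 0 := by rw [hN, comp_nil, σ.M_nil]
  have hR : comp σ.R (leftDilate ((1 + N) * K)) = N :=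
    comp_momentOfFree_eq_iff.1 (by rw [hN, ← momentOfFree_unique _ _ σ.R_spec])
  have hM : (freeConv σ (delta a)).M = (1 + N) * K - 1 := by
    rw [momentOfFree_unique _ _ (freeConv σ (delta a)).R_spec]
    refine (momentOfFree_unique _ _ ?_).symm
    rw [add_sub_cancel, R_freeConv, R_delta, add_comp, linSeries_comp_leftDilate, hR, mul_assoc, hK,
      one_add_M_delta_mul_linSeries]
    noncomm_ring
  have h_comp : comp σ.eta (leftDilate K) = 1 - inv (1 + N) := by
    rw [eta, etaOf, sub_comp, one_comp (leftDilate_nil K),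
      inv_comp (one_add_nil σ.M_nil) (leftDilate_nil K), add_comp, one_comp (leftDilate_nil K)]
  rw [condSeries, ← hK, h_comp, eta, etaOf, hM, add_sub_cancel,
    inv_mul_rev (one_add_nil hN_nil) hK_nil, linSeries_neg, mul_sub, mul_one, hK,
    inv_one_add_M_delta]
  noncomm_ring

theorem eta_B (a : Fin d → ℝ) (t : ℝ) (ρ : Functional d) : (B a t ρ).eta =
    ((1 / (1 + t) : ℝ) : ℂ) • condSeries (ρ.freePow (1 + t)).eta (delta a).M := by
  rw [B, eta_boolPow, eta_boolConv, eta_delta (-a), eta_freeConv_delta]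

theorem eta_BP (σ : Functional d) : (BP σ).eta = ((1 / 2 : ℝ) : ℂ) • (σ.freePow 2).eta := by
  rw [BP, eta_B, M_delta_zero, condSeries_zero_right]
  norm_num

theorem R_BP (σ : Functional d) : (BP σ).R = σ.eta := by
  set M₂ := (σ.freePow 2).M with hM₂
  set K := 1 + (BP σ).M with hK
  set N : NCSeries d := (1 / 2 : ℂ) • M₂ with hN
  have hK_nil : K [] = 1 := one_add_nil (M_nil _)
  have hM₂_nil : M₂ [] = 0 := M_nil _
  have hN_nil : N [] = 0 := by rw [hN, NCSeries.smul_apply, hM₂_nil, mul_zero]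
  have h_mul : (1 + N) * K = 1 + M₂ := by
    have h_inv : (1 + M₂) * inv K = 1 + N := by
      rw [hK, inv_one_add, ← eta, eta_BP, mul_sub, mul_one, NCSeries.mul_smul', eta, ← hM₂,
        mul_etaOf hM₂_nil, hN]
      push_cast
      module
    rw [← h_inv, mul_assoc, inv_mul K hK_nil, mul_one]
  have hN_R : comp σ.R (leftDilate ((1 + N) * K)) = N := by
    have h_spec := (σ.freePow 2).R_spec
    rw [R_freePow, smul_comp, ← hM₂] at h_spec
    rw [h_mul, hN]
    conv_rhs => rw [← h_spec, smul_smul]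
    norm_num
  have hN_M : comp σ.M (leftDilate K) = N := by
    rw [momentOfFree_unique _ _ σ.R_spec, comp_momentOfFree_eq_iff, hN_R]
  refine (freeOf_unique _ _ (M_nil _) ?_).symm
  have hN_nil' := one_add_nil hN_nil
  have hN_eq : N = (1 + N) * K - (1 + N) := by
    rw [h_mul, hN]
    module
  calc comp σ.eta (leftDilate K) = 1 - inv (1 + N) := by
        rw [eta, etaOf, sub_comp, one_comp (leftDilate_nil K),
          inv_comp (one_add_nil σ.M_nil) (leftDilate_nil K), add_comp,
          one_comp (leftDilate_nil K), hN_M]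
    _ = inv (1 + N) * (1 + N - 1) := by rw [mul_sub, inv_mul _ hN_nil', mul_one]
    _ = inv (1 + N) * ((1 + N) * K - (1 + N)) := by rw [add_sub_cancel_left, ← hN_eq]
    _ = (BP σ).M := by
        rw [mul_sub, ← mul_assoc, inv_mul _ hN_nil', one_mul, hK, add_sub_cancel_left]

theorem BP_bijective : Function.Bijective (BP : Functional d → Functional d) := by
  refine ⟨fun σ σ' h => ext_eta ?_, fun ρ => ⟨ofEta ρ.R ρ.R_nil ρ.adj_R, ext_R ?_⟩⟩
  · rw [← R_BP, h, R_BP]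
  · rw [R_BP, eta_ofEta]

theorem eta_invFun_BP (ρ : Functional d) : (Function.invFun BP ρ).eta = ρ.R := by
  rw [← R_BP, Function.invFun_eq (BP_bijective.2 ρ)]

theorem Phi_delta_zero (ρ : Functional d) : Phi ρ (delta 0) = Function.invFun BP ρ := by
  apply ext_eta
  rw [eta_Phi_eq_condSeries, M_delta_zero, condSeries_zero_right, eta_invFun_BP]

theorem Phi_delta_eq_B (ρ : Functional d) (a : Fin d → ℝ) :
    Phi ρ (delta a) = B a 0 (Function.invFun BP ρ) := by
  apply ext_eta
  rw [eta_Phi_eq_condSeries, eta_B, add_zero, freePow_one, eta_invFun_BP, div_one,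
    Complex.ofReal_one, one_smul]

theorem tendsto_B (ρ : Functional d) (a : Fin d → ℝ) (p : NCPoly d) :
    Tendsto (fun t : ℝ => B a t ρ p) (𝓝[≠] (-1)) (𝓝 (Phi ρ (delta a) p)) := by
  refine tendsto_apply ?_ p
  have h_shift : Tendsto (fun t : ℝ => 1 + t) (𝓝[≠] (-1)) (𝓝[≠] 0) := by
    have h_map := (Homeomorph.addLeft (1 : ℝ)).map_punctured_nhds_eq (-1)
    simp only [Homeomorph.coe_addLeft, add_neg_cancel] at h_map
    exact h_map.le
  have h_cont : Continuous fun R => condSeries R (delta a).M :=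
    continuous_condSeries continuous_id continuous_const
  simp only [eta_B, one_div, ← condSeries_smul, eta_Phi_eq_condSeries]
  exact (h_cont.tendsto _).comp ((tendsto_eta_freePow_div ρ).comp h_shift)

end Functional

/-! ### The series `∑ i, w_i (1 - ∑ j, a i j w_j)⁻¹ w_i` -/

namespace Functional

open NCSeries
open scoped ComplexOrder

variable {d : ℕ}

/-- The series `∑ i, w_i (1 - ∑ j, a i j w_j)⁻¹ w_i`. It is the free cumulant series of the free
product of standard semicircular distributions when `a = 0`, and that of a centered free Poisson
distribution when `d = 1`. In general its coefficients of the words `[i, j, i]` can be prescribed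
freely, and the states with this Boolean cumulant series serve as test states. -/
noncomputable def sandwichSeries (a : Fin d → Fin d → ℝ) : NCSeries d :=
  ∑ i, X i * ((1 + (delta (a i)).M) * X i)

theorem sandwichSeries_nil (a : Fin d → Fin d → ℝ) : sandwichSeries a [] = 0 := by
  rw [sandwichSeries, NCSeries.sum_apply]
  exact sum_eq_zero fun i _ => by rw [mul_nil, X_nil, zero_mul]

theorem sandwichSeries_singleton (a : Fin d → Fin d → ℝ) (i : Fin d) :
    sandwichSeries a [i] = 0 := by
  rw [sandwichSeries, sum_X_mul_cons, mul_nil, X_nil, mul_zero]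

theorem sandwichSeries_cons_concat (a : Fin d → Fin d → ℝ) (i j : Fin d) (u : List (Fin d)) :
    sandwichSeries a (i :: (u ++ [j])) = if i = j then (((u.map (a i)).prod : ℝ) : ℂ) else 0 := by
  rw [sandwichSeries, sum_X_mul_cons, mul_concat, X_nil, mul_zero, add_zero, rightD_X]
  by_cases h : i = j
  · rw [if_pos h.symm, if_pos h, mul_one, one_add_M_delta_apply]
  · rw [if_neg (Ne.symm h), if_neg h, mul_zero, NCSeries.zero_apply]

theorem adj_sandwichSeries (a : Fin d → Fin d → ℝ) :
    NCSeries.adj (sandwichSeries a) = sandwichSeries a := by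
  rw [sandwichSeries, NCSeries.adj_sum]
  refine sum_congr rfl fun i _ => ?_
  rw [NCSeries.adj_mul, NCSeries.adj_mul, NCSeries.adj_X, NCSeries.adj_add, NCSeries.adj_one,
    adj_M, mul_assoc]

theorem condPos_sandwichSeries (a : Fin d → Fin d → ℝ) : CondPos (sandwichSeries a) := by
  have h_sum : condHankel (sandwichSeries a) = ∑ k, Matrix.of
      fun b c : List (Fin d) × Fin d =>
        star (if b.2 = k then (((b.1.map (a k)).prod : ℝ) : ℂ) else 0) *
          if c.2 = k then (((c.1.map (a k)).prod : ℝ) : ℂ) else 0 := by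
    ext ⟨s, i⟩ ⟨t, j⟩
    rw [condHankel_apply, sandwichSeries_cons_concat, Matrix.sum_apply, sum_eq_single i]
    · by_cases h : i = j
      · simp [h, List.prod_reverse]
      · simp [h, Ne.symm h]
    · intro k _ hk
      simp [hk.symm]
    · simp
  rw [CondPos, h_sum]
  exact Matrix.posSemidef_sum _ fun k _ => posSemidef_star_mul _

/-- The state with Boolean cumulant series `sandwichSeries a`. For `a = 0` it is the Boolean product
of symmetric Bernoulli distributions. -/
noncomputable def sandwichState (a : Fin d → Fin d → ℝ) : Functional d :=
  ofEta (sandwichSeries a) (sandwichSeries_nil a) (adj_sandwichSeries a)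

theorem eta_sandwichState (a : Fin d → Fin d → ℝ) : (sandwichState a).eta = sandwichSeries a :=
  eta_ofEta _ _ _

theorem isState_sandwichState (a : Fin d → Fin d → ℝ) : (sandwichState a).IsState := by
  rw [isState_iff_condPos_eta, eta_sandwichState]
  exact condPos_sandwichSeries a

theorem sandwichSeries_pair (a : Fin d → Fin d → ℝ) (i j : Fin d) :
    sandwichSeries a [i, j] = if i = j then 1 else 0 := by
  simpa using sandwichSeries_cons_concat a i j []

theorem sandwichSeries_triple (a : Fin d → Fin d → ℝ) (i k j : Fin d) :
    sandwichSeries a [i, k, j] = if i = j then (a i k : ℂ) else 0 := by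
  simpa using sandwichSeries_cons_concat a i j [k]

theorem mean_sandwichState (a : Fin d → Fin d → ℝ) : (sandwichState a).mean = 0 := by
  funext i
  rw [mean_apply, eta_sandwichState, sandwichSeries_singleton, Pi.zero_apply]

theorem cov_sandwichState (a : Fin d → Fin d → ℝ) : (sandwichState a).cov = 1 := by
  ext i j
  rw [cov_apply, eta_sandwichState, sandwichSeries_pair, Matrix.one_apply]

/-! ### Surjectivity of the maps `Φ[ρ, ·]` and `Φ[·, ψ]` -/

theorem condSeries_eq_sandwichSeries {ρ ψ : Functional d} {a : Fin d → Fin d → ℝ}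
    (h : Phi ρ ψ = sandwichState a) : condSeries ρ.R ψ.M = sandwichSeries a := by
  rw [← eta_Phi_eq_condSeries, h, eta_sandwichState]

theorem R_pair_of_cov_eq_one {ρ : Functional d} (h : ρ.cov = 1) (i j : Fin d) :
    ρ.R [i, j] = if i = j then 1 else 0 := by
  rw [← eta_pair, ← cov_apply, h, Matrix.one_apply]

theorem Phi_image_ne {ρ : Functional d} (hd : 2 ≤ d) (hmean : ρ.mean = 0) (hcov : ρ.cov = 1) :
    {φ | ∃ ψ : Functional d, ψ.IsState ∧ Phi ρ ψ = φ} ≠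
      {φ : Functional d | φ.IsState ∧ φ.mean = ρ.mean ∧ φ.cov = ρ.cov} := by
  intro h_image
  obtain ⟨i, j, hij⟩ : ∃ i j : Fin d, j ≠ i :=
    ⟨⟨0, by omega⟩, ⟨1, by omega⟩, by simp⟩
  -- The two coefficients `[i, i, i]` and `[j, i, j]` of `η^Φ[ρ, ψ]` are both shifted by `ψ[x_i]`.
  have h_difference : ∀ a : Fin d → Fin d → ℝ,
      (a i i : ℂ) - a j i = ρ.R [i, i, i] - ρ.R [j, i, j] := by
    intro a
    obtain ⟨ψ, -, hψ⟩ := h_image.ge ⟨isState_sandwichState a,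
      by rw [mean_sandwichState, hmean], by rw [cov_sandwichState, hcov]⟩
    have h_triple : ∀ k, ρ.R [k, i, k] + ψ.M [i] = a k i := fun k => by
      have h := condSeries_triple ρ.R_nil ψ.M_nil k i k
      rw [condSeries_eq_sandwichSeries hψ, sandwichSeries_triple, R_pair_of_cov_eq_one hcov,
        if_pos rfl, if_pos rfl, one_mul] at h
      exact h.symm
    rw [← h_triple i, ← h_triple j, add_sub_add_right_eq_sub]
  have h_absurd := (h_difference fun k _ => if k = i then 1 else 0).trans (h_difference 0).symm
  simp [hij] at h_absurd

theorem degenerate_of_Phi_eq_sandwichState_zero {ρ ψ : Functional d} (hρ : ρ.R.CondPos)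
    (hψ : ψ.IsState) (h : Phi ρ ψ = sandwichState 0) (i : Fin d) :
    ρ.R [i, i, i, i] = ρ.R [i, i, i] * ρ.R [i, i, i] ∧ ψ.M [i, i] = ψ.M [i] * ψ.M [i] := by
  have h_eta := condSeries_eq_sandwichSeries h
  have h2 : ρ.R [i, i] = 1 := by
    rw [← condSeries_pair ρ.R_nil ψ.M_nil, h_eta, sandwichSeries_pair, if_pos rfl]
  have h3 : ρ.R [i, i, i] + ψ.M [i] = 0 := by
    have h := condSeries_triple ρ.R_nil ψ.M_nil i i i
    rw [h_eta, sandwichSeries_triple, h2] at h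
    simpa using h.symm
  have h4 : ρ.R [i, i, i, i] + 2 * (ρ.R [i, i, i] * ψ.M [i]) + ψ.M [i, i] = 0 := by
    have h_zero : sandwichSeries (0 : Fin d → Fin d → ℝ) [i, i, i, i] = 0 := by
      simpa using sandwichSeries_cons_concat 0 i i [i, i]
    have h := condSeries_quadruple ρ.R_nil ψ.M_nil i i i i
    rw [h_eta, h2, h_zero] at h
    linear_combination -h
  have hR_le : ρ.R [i, i, i] * ρ.R [i, i, i] ≤ ρ.R [i, i, i, i] :=
    mul_apply_le_of_posSemidef (p := ([i], i)) (q := ([], i)) hρ h2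
  have hM_le : ψ.M [i] * ψ.M [i] ≤ ψ.M [i, i] := by
    simpa [hankel_apply, one_add_cons] using mul_apply_le_of_posSemidef (p := [i]) (q := [])
      ((isState_iff_posSemidef ψ).1 hψ) (one_add_nil ψ.M_nil)
  have h_sum : ρ.R [i, i, i, i] - ρ.R [i, i, i] * ρ.R [i, i, i] +
      (ψ.M [i, i] - ψ.M [i] * ψ.M [i]) = 0 := by
    linear_combination h4 - (ρ.R [i, i, i] + ψ.M [i]) * h3
  obtain ⟨hR, hM⟩ :=
    (add_eq_zero_iff_of_nonneg (sub_nonneg.2 hR_le) (sub_nonneg.2 hM_le)).1 h_sum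
  exact ⟨sub_eq_zero.1 hR, sub_eq_zero.1 hM⟩

theorem eq_delta_of_variance_eq_zero {ψ : Functional d} (hψ : ψ.IsState)
    (h : ∀ i, ψ.M [i, i] = ψ.M [i] * ψ.M [i]) : ψ = delta fun i => (ψ.M [i]).re := by
  have h_real : ∀ i, ((ψ.M [i]).re : ℂ) = ψ.M [i] := fun i =>
    Complex.conj_eq_iff_re.1 (conj_apply_of_adj_eq ψ.adj_M [i])
  have h_concat : ∀ (w : List (Fin d)) (i : Fin d),
      (1 + ψ.M) (w ++ [i]) = (1 + ψ.M) w * ψ.M [i] := by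
    intro w i
    have h_var : hankel (1 + ψ.M) [i] [i] = hankel (1 + ψ.M) [i] [] * hankel (1 + ψ.M) [] [i] := by
      simpa [hankel_apply, one_add_cons] using h i
    simpa [hankel_apply, one_add_cons] using apply_eq_mul_of_posSemidef (q := [])
      ((isState_iff_posSemidef ψ).1 hψ) (one_add_nil ψ.M_nil) h_var w.reverse
  refine ext_M (add_left_cancel (a := (1 : NCSeries d)) ?_)
  ext w
  rw [one_add_M_delta_apply]
  induction w using List.reverseRecOn with
  | nil => exact one_add_nil ψ.M_nil
  | append_singleton w i ih => simp [h_concat, ih, h_real]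

theorem exists_isFreelyInfDiv_Phi_delta_eq {φ : Functional d} (hφ : φ.IsState) (a : Fin d → ℝ) :
    ∃ ρ : Functional d, ρ.IsFreelyInfDiv ∧ Phi ρ (delta a) = φ := by
  let σ : Functional d := ofR φ.eta φ.eta_nil φ.adj_eta
  have hσ : σ.R = φ.eta := R_ofR _ _ _
  let τ : Functional d := Phi σ (delta (-a))
  have hτ : τ.IsState :=
    isState_Phi (hσ ▸ (isState_iff_condPos_eta φ).1 hφ) (isState_delta _)
  let ρ : Functional d := ofR τ.eta τ.eta_nil τ.adj_eta
  have hρ : ρ.R = τ.eta := R_ofR _ _ _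
  refine ⟨ρ, (isFreelyInfDiv_iff_condPos ρ).2 (hρ ▸ (isState_iff_condPos_eta τ).1 hτ),
    ext_eta ?_⟩
  rw [eta_Phi_eq_condSeries, hρ, eta_Phi_eq_condSeries, hσ, condSeries_condSeries_delta,
    add_neg_cancel, M_delta_zero, condSeries_zero_right]

theorem Phi_onto_iff {ψ : Functional d} (hψ : ψ.IsState) :
    {φ | ∃ ρ : Functional d, ρ.IsFreelyInfDiv ∧ Phi ρ ψ = φ} = {φ : Functional d | φ.IsState} ↔
      ∃ a : Fin d → ℝ, ψ = delta a := by
  constructor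
  · intro h_onto
    obtain ⟨ρ, hρ, h⟩ := h_onto.ge (isState_sandwichState 0)
    exact ⟨_, eq_delta_of_variance_eq_zero hψ fun i =>
      (degenerate_of_Phi_eq_sandwichState_zero hρ.condPos hψ h i).2⟩
  · rintro ⟨a, rfl⟩
    refine Set.Subset.antisymm ?_ fun φ hφ => exists_isFreelyInfDiv_Phi_delta_eq hφ a
    rintro _ ⟨ρ, hρ, rfl⟩
    exact isState_Phi hρ.condPos hψ

end Functional

/-! ### Jacobi parameters and free Poisson distributions -/

namespace Functional

open NCSeries
open scoped ComplexOrder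

/-- The generating series, over words in a single letter, of the `k`-th entries of the vectors
`J ^ n e₀`, where `J` is the Jacobi operator. -/
noncomputable def jacobiColumn (β γ : ℕ → ℝ) (k : ℕ) : NCSeries 1 :=
  fun u => ((jacobiOp β γ ^ u.length) (Pi.single 0 1) k : ℝ)

theorem jacobiColumn_zero (β γ : ℕ → ℝ) : jacobiColumn β γ 0 = 1 + (ofJacobi β γ).M := by
  ext u
  rw [ofJacobi, M_ofM, NCSeries.add_apply, NCSeries.one_apply, jacobiSeries, jacobiColumn]
  by_cases h : u = [] <;> simp [h]

theorem leftD_jacobiColumn_zero (β γ : ℕ → ℝ) (i : Fin 1) :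
    leftD i (jacobiColumn β γ 0) =
      (β 0 : ℂ) • jacobiColumn β γ 0 + (γ 1 : ℂ) • jacobiColumn β γ 1 := by
  ext u
  simp [leftD_apply, jacobiColumn, pow_succ', jacobiOp, NCSeries.add_apply, NCSeries.smul_apply,
    -Complex.coe_smul]

theorem leftD_jacobiColumn_succ (β γ : ℕ → ℝ) (k : ℕ) (i : Fin 1) :
    leftD i (jacobiColumn β γ (k + 1)) = jacobiColumn β γ k +
      (β (k + 1) : ℂ) • jacobiColumn β γ (k + 1) + (γ (k + 2) : ℂ) • jacobiColumn β γ (k + 2) := by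
  ext u
  simp [leftD_apply, jacobiColumn, pow_succ', jacobiOp, NCSeries.add_apply, NCSeries.smul_apply,
    -Complex.coe_smul]

-- Decompose a path from level `0` to level `k + 1` at its last step from level `0` to level `1`.
theorem jacobiColumn_succ (β γ : ℕ → ℝ) (k : ℕ) :
    jacobiColumn β γ (k + 1) =
      jacobiColumn (fun n => β (n + 1)) (fun n => γ (n + 1)) k * (X 0 * jacobiColumn β γ 0) := by
  ext u
  induction u generalizing k with
  | nil => simp [mul_nil, X_nil, jacobiColumn]
  | cons i u ih =>
    have h_X : (X 0 * jacobiColumn β γ 0 : NCSeries 1) (i :: u) = jacobiColumn β γ 0 u := by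
      simp [mul_cons, leftD_X, X_nil, Subsingleton.elim i 0]
    rw [← leftD_apply i (jacobiColumn β γ (k + 1)), leftD_jacobiColumn_succ, mul_cons, h_X]
    cases k with
    | zero =>
      simp only [NCSeries.add_apply, NCSeries.smul_apply, ih, leftD_jacobiColumn_zero, add_mul,
        NCSeries.smul_mul']
      simp [jacobiColumn]
      ring
    | succ k =>
      simp only [NCSeries.add_apply, NCSeries.smul_apply, ih, leftD_jacobiColumn_succ, add_mul,
        NCSeries.smul_mul']
      simp [jacobiColumn]

theorem eta_PhiOne {d : ℕ} (ψ : Functional d) :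
    (PhiOne ψ).eta = ∑ i, X i * ((1 + ψ.M) * X i) := by
  simp only [← mul_assoc]
  exact eta_ofEta _ _ _

theorem eta_ofJacobi (β γ : ℕ → ℝ) : (ofJacobi β γ).eta = linSeries (fun _ => β 0) +
    (γ 1 : ℂ) • (PhiOne (ofJacobi (fun n => β (n + 1)) fun n => γ (n + 1))).eta := by
  rw [eta_PhiOne, ← jacobiColumn_zero, Fin.sum_univ_one]
  refine etaOf_eq_of_mul_eq (M_nil _) ?_
  rw [add_mul, NCSeries.smul_mul', mul_assoc, mul_assoc, ← jacobiColumn_zero, ← jacobiColumn_succ]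
  ext u
  cases u with
  | nil =>
    rw [NCSeries.add_apply, NCSeries.smul_apply, mul_nil, mul_nil, linSeries_nil, X_nil, M_nil]
    simp
  | cons i u =>
    rw [← one_add_cons (ofJacobi β γ).M, ← jacobiColumn_zero, ← leftD_apply i (jacobiColumn β γ 0),
      leftD_jacobiColumn_zero, NCSeries.add_apply, NCSeries.smul_apply, linSeries_mul_cons]
    simp [NCSeries.add_apply, NCSeries.smul_apply, mul_cons, leftD_X, X_nil,
      Subsingleton.elim i 0, -Complex.coe_smul]

theorem comp_one_add_M_delta_mul {d : ℕ} (ψ : Functional d) (a : Fin d → ℝ) :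
    comp (1 + (delta a).M) (leftDilate (1 + ψ.M)) * (1 + ψ.M) = 1 + (boolConv ψ (delta a)).M := by
  set G := 1 + ψ.M with hG
  set S := comp (1 + (delta a).M) (leftDilate G)
  have hG_nil : G [] = 1 := one_add_nil ψ.M_nil
  have h_comp : (1 - G * linSeries a) * S = 1 := by
    rw [← linSeries_comp_leftDilate, ← one_comp (leftDilate_nil G), ← sub_comp,
      ← inv_one_add_M_delta, ← mul_comp _ _ (leftDilate_nil G),
      inv_mul _ (one_add_nil (M_nil _))]
  have h_inv : inv (1 + (boolConv ψ (delta a)).M) * (S * G) = 1 := by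
    rw [inv_one_add, ← eta, eta_boolConv, eta_delta, ← sub_sub, eta, ← inv_one_add, ← hG]
    calc (inv G - linSeries a) * (S * G)
        = inv G * ((1 - G * linSeries a) * S) * G := by
          rw [← mul_assoc (inv G), mul_sub, mul_one, ← mul_assoc (inv G), inv_mul G hG_nil, one_mul,
            mul_assoc]
      _ = 1 := by rw [h_comp, mul_one, inv_mul G hG_nil]
  calc S * G = (1 + (boolConv ψ (delta a)).M) * inv (1 + (boolConv ψ (delta a)).M) * (S * G) := by
        rw [mul_inv _ (one_add_nil (M_nil _)), one_mul]
    _ = 1 + (boolConv ψ (delta a)).M := by rw [mul_assoc, h_inv, mul_one]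

theorem eta_Phi_of_R_eq_sandwichSeries {d : ℕ} {ρ : Functional d} {a : Fin d → Fin d → ℝ}
    (h : ρ.R = sandwichSeries a) (ψ : Functional d) :
    (Phi ρ ψ).eta = ∑ i, X i * ((1 + (boolConv ψ (delta (a i))).M) * X i) := by
  rw [eta_Phi_eq_condSeries, h, condSeries, sandwichSeries, sum_comp, mul_sum]
  refine sum_congr rfl fun i _ => ?_
  have hG := leftDilate_nil (1 + ψ.M)
  rw [mul_comp _ _ hG, mul_comp _ _ hG, X_comp i hG, leftDilate, ← mul_assoc,
    ← mul_assoc (inv _), inv_mul _ (one_add_nil ψ.M_nil), one_mul, ← mul_assoc (comp _ _),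
    comp_one_add_M_delta_mul]

theorem Phi_eq_PhiOne_boolConv {d : ℕ} {ρ : Functional d} {a : Fin d → ℝ}
    (h : ρ.R = sandwichSeries fun _ => a) (ψ : Functional d) :
    Phi ρ ψ = PhiOne (boolConv ψ (delta a)) :=
  ext_eta (by rw [eta_Phi_of_R_eq_sandwichSeries h, eta_PhiOne])

theorem boolConv_delta_zero {d : ℕ} (ψ : Functional d) : boolConv ψ (delta 0) = ψ :=
  ext_eta (by simp [eta_boolConv, eta_delta, linSeries])

theorem Phi_eq_PhiOne {d : ℕ} {ρ : Functional d} (h : ρ.R = sandwichSeries 0)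
    (ψ : Functional d) : Phi ρ ψ = PhiOne ψ := by
  rw [Phi_eq_PhiOne_boolConv (a := 0) h, boolConv_delta_zero]

theorem freeMeixner_eq_PhiOne (b : ℝ) :
    freeMeixner b 0 = PhiOne (ofJacobi (fun _ => b) fun _ => 1) :=
  ext_eta (by simp [freeMeixner, eta_ofJacobi, linSeries])

theorem boolConv_freeMeixner_delta (b : ℝ) :
    boolConv (freeMeixner b 0) (delta fun _ => b) = ofJacobi (fun _ => b) fun _ => 1 :=
  ext_eta (by rw [eta_boolConv, eta_ofJacobi, eta_delta, freeMeixner_eq_PhiOne, add_comm,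
    Complex.ofReal_one, one_smul])

theorem R_freeMeixner (b : ℝ) : (freeMeixner b 0).R = sandwichSeries fun _ _ => b := by
  let σ : Functional 1 :=
    ofR (sandwichSeries fun _ _ => b) (sandwichSeries_nil _) (adj_sandwichSeries _)
  have hσ : σ.R = sandwichSeries fun _ _ => b := R_ofR _ _ _
  have h_fixed : Phi σ (freeMeixner b 0) = freeMeixner b 0 := by
    rw [Phi_eq_PhiOne_boolConv hσ, boolConv_freeMeixner_delta, ← freeMeixner_eq_PhiOne]
  rw [(Phi_eq_right_iff _ _).1 h_fixed, hσ]

theorem isFreelyInfDiv_freeMeixner (b : ℝ) : (freeMeixner b 0).IsFreelyInfDiv := by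
  rw [isFreelyInfDiv_iff_condPos, R_freeMeixner]
  exact condPos_sandwichSeries _

theorem mean_freeMeixner (b : ℝ) : (freeMeixner b 0).mean = 0 := by
  funext i
  rw [mean_apply, eta_singleton, R_freeMeixner, sandwichSeries_singleton, Pi.zero_apply]

theorem cov_freeMeixner (b : ℝ) : (freeMeixner b 0).cov = 1 := by
  ext i j
  rw [cov_apply, eta_pair, R_freeMeixner, sandwichSeries_pair, Matrix.one_apply]

theorem Phi_freeMeixner (b : ℝ) (ψ : Functional 1) :
    Phi (freeMeixner b 0) ψ = PhiOne (boolConv ψ (delta fun _ => b)) :=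
  Phi_eq_PhiOne_boolConv (R_freeMeixner b) ψ

theorem Phi_freeMeixner_zero (ψ : Functional 1) : Phi (freeMeixner 0 0) ψ = PhiOne ψ :=
  Phi_eq_PhiOne (R_freeMeixner 0) ψ

theorem sandwichSeries_zero {d : ℕ} : sandwichSeries (0 : Fin d → Fin d → ℝ) = ∑ i, X i * X i := by
  simp only [sandwichSeries, Pi.zero_apply, M_delta_zero, add_zero, one_mul]

theorem X_mul_X_apply {d : ℕ} (i j : Fin d) (u : List (Fin d)) :
    (X i * X j : NCSeries d) u = if u = [i, j] then 1 else 0 := by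
  cases u with
  | nil => simp [mul_nil, X_nil]
  | cons k u => by_cases h : k = i <;> simp [mul_cons, leftD_X, h, X, NCSeries.zero_apply]

theorem marginSeries_freeMeixner {d : ℕ} (i : Fin d) :
    marginSeries i (freeMeixner 0 0) = X i * X i := by
  have h_R : (freeMeixner 0 0).R = X 0 * X 0 :=
    (R_freeMeixner 0).trans (sandwichSeries_zero.trans (Fin.sum_univ_one _))
  ext u
  rw [marginSeries, h_R, X_mul_X_apply, X_mul_X_apply, ← ite_and]
  refine if_congr ?_ rfl rfl
  change _ ∧ List.replicate u.length 0 = List.replicate 2 0 ↔ u = List.replicate 2 i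
  rw [List.eq_replicate_iff (l := u), List.replicate_inj, and_comm]
  simp

theorem R_freeProd_semicircular {d : ℕ} :
    (freeProd fun _ : Fin d => freeMeixner 0 0).R = sandwichSeries 0 := by
  rw [freeProd, R_ofR, sandwichSeries_zero]
  exact sum_congr rfl fun i _ => marginSeries_freeMeixner i

theorem Phi_freeProd_semicircular {d : ℕ} (ψ : Functional d) :
    Phi (freeProd fun _ => freeMeixner 0 0) ψ = PhiOne ψ :=
  Phi_eq_PhiOne R_freeProd_semicircular ψ

/-! ### The image of `Φ[ρ, ·]` in one variable -/

theorem exists_PhiOne_eq {φ : Functional 1} (hφ : φ.IsState) (hmean : φ.mean = 0)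
    (hcov : φ.cov = 1) : ∃ ψ : Functional 1, ψ.IsState ∧ PhiOne ψ = φ := by
  have h_adj : NCSeries.adj (leftD 0 (rightD 0 φ.eta) - 1) = leftD 0 (rightD 0 φ.eta) - 1 := by
    rw [NCSeries.adj_sub, NCSeries.adj_one]
    congr 1
    ext u
    have h_word : (0 :: (u.reverse ++ [0])).reverse = 0 :: (u ++ [0]) := by simp
    rw [NCSeries.adj_apply, leftD_apply, rightD_apply, leftD_apply, rightD_apply,
      List.cons_append, List.cons_append, conj_apply_of_adj_eq φ.adj_eta, h_word]
  have h_nil : (leftD 0 (rightD 0 φ.eta) - 1) [] = 0 := by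
    rw [NCSeries.sub_apply, leftD_apply, rightD_apply, List.singleton_append, ← cov_apply, hcov]
    simp [NCSeries.one_apply]
  let ψ : Functional 1 := ofM (leftD 0 (rightD 0 φ.eta) - 1) h_nil h_adj
  have h_M : 1 + ψ.M = leftD 0 (rightD 0 φ.eta) := by rw [M_ofM, add_sub_cancel]
  refine ⟨ψ, ?_, ext_eta ?_⟩
  · rw [isState_iff_posSemidef, h_M]
    exact ((isState_iff_condPos_eta φ).1 hφ).submatrix fun w : List (Fin 1) => (w, (0 : Fin 1))
  · rw [eta_PhiOne, h_M]
    refine ext_cons_concat ?_ (fun i => ?_) fun i j u => ?_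
    · rw [Fin.sum_univ_one, mul_nil, X_nil, zero_mul, eta_nil]
    · rw [sum_X_mul_cons, mul_nil, X_nil, mul_zero, ← mean_apply, hmean, Pi.zero_apply]
    · rw [sum_X_mul_cons, Subsingleton.elim i 0, Subsingleton.elim j 0, mul_concat, rightD_X]
      simp [X_nil, leftD_apply, rightD_apply]

theorem isState_boolConv_delta {d : ℕ} {ψ : Functional d} (hψ : ψ.IsState) (a : Fin d → ℝ) :
    (boolConv ψ (delta a)).IsState := by
  rw [isState_iff_condPos_eta] at hψ ⊢
  rwa [eta_boolConv, eta_delta, CondPos, condHankel_congr (F' := ψ.eta)]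
  intro u hu
  rw [NCSeries.add_apply, linSeries_of_two_le _ hu, add_zero]

theorem boolConv_delta_neg_cancel {d : ℕ} (ψ : Functional d) (a : Fin d → ℝ) :
    boolConv (boolConv ψ (delta (-a))) (delta a) = ψ :=
  ext_eta (by
    rw [eta_boolConv, eta_boolConv, eta_delta, eta_delta, linSeries_neg, neg_add_cancel_right])

theorem Phi_freeMeixner_image (b : ℝ) :
    {φ | ∃ ψ : Functional 1, ψ.IsState ∧ Phi (freeMeixner b 0) ψ = φ} =
      {φ : Functional 1 | φ.IsState ∧ φ.mean = (freeMeixner b 0).mean ∧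
        φ.cov = (freeMeixner b 0).cov} := by
  ext φ
  constructor
  · rintro ⟨ψ, hψ, rfl⟩
    exact ⟨isState_Phi (isFreelyInfDiv_freeMeixner b).condPos hψ, mean_Phi _ _, cov_Phi _ _⟩
  · rintro ⟨hφ, hmean, hcov⟩
    rw [mean_freeMeixner] at hmean
    rw [cov_freeMeixner] at hcov
    obtain ⟨ψ, hψ, rfl⟩ := exists_PhiOne_eq hφ hmean hcov
    refine ⟨boolConv ψ (delta (-fun _ => b)), isState_boolConv_delta hψ _, ?_⟩
    rw [Phi_freeMeixner, boolConv_delta_neg_cancel]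

theorem eq_freeMeixner_of_degenerate {ρ : Functional 1} (hρ : ρ.R.CondPos) (hmean : ρ.mean = 0)
    (hcov : ρ.cov = 1) (h : ρ.R [0, 0, 0, 0] = ρ.R [0, 0, 0] * ρ.R [0, 0, 0]) :
    ∃ b : ℝ, ρ = freeMeixner b 0 := by
  have h_pair : ρ.R [0, 0] = 1 := by rw [R_pair_of_cov_eq_one hcov, if_pos rfl]
  have h_real : ((ρ.R [0, 0, 0]).re : ℂ) = ρ.R [0, 0, 0] :=
    Complex.conj_eq_iff_re.1 (conj_apply_of_adj_eq ρ.adj_R [0, 0, 0])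
  have h_concat : ∀ w : List (Fin 1),
      ρ.R (0 :: (w ++ [0] ++ [0])) = ρ.R (0 :: (w ++ [0])) * ρ.R [0, 0, 0] := fun w => by
    simpa [condHankel_apply] using apply_eq_mul_of_posSemidef
      (p := (([0], 0) : List (Fin 1) × Fin 1)) (q := ([], 0)) hρ h_pair h (w.reverse, 0)
  refine ⟨(ρ.R [0, 0, 0]).re, ext_R ?_⟩
  rw [R_freeMeixner]
  refine ext_cons_concat ?_ (fun i => ?_) fun i j u => ?_
  · rw [ρ.R_nil, sandwichSeries_nil]
  · rw [sandwichSeries_singleton, ← eta_singleton, ← mean_apply, hmean, Pi.zero_apply]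
  · rw [sandwichSeries_cons_concat, if_pos (Subsingleton.elim i j), Subsingleton.elim i 0,
      Subsingleton.elim j 0]
    induction u using List.reverseRecOn with
    | nil => simpa using h_pair
    | append_singleton w k ih =>
      rw [Subsingleton.elim k 0, h_concat, ih]
      simp [h_real]

theorem Phi_image_eq_iff {ρ : Functional 1} (hρ : ρ.IsFreelyInfDiv) (hmean : ρ.mean = 0)
    (hcov : ρ.cov = 1) :
    {φ | ∃ ψ : Functional 1, ψ.IsState ∧ Phi ρ ψ = φ} =
        {φ : Functional 1 | φ.IsState ∧ φ.mean = ρ.mean ∧ φ.cov = ρ.cov} ↔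
      ∃ b : ℝ, ρ = freeMeixner b 0 := by
  constructor
  · intro h_image
    obtain ⟨ψ, hψ, h⟩ := h_image.ge ⟨isState_sandwichState 0,
      by rw [mean_sandwichState, hmean], by rw [cov_sandwichState, hcov]⟩
    exact eq_freeMeixner_of_degenerate hρ.condPos hmean hcov
      (degenerate_of_Phi_eq_sandwichState_zero hρ.condPos hψ h 0).1
  · rintro ⟨b, rfl⟩
    exact Phi_freeMeixner_image b

end Functional

open Functional in
theorem mainTheorem4 (d : ℕ) :
    -- (a) for `φ = Φ[ρ, ψ]`, any two of `φ, ρ, ψ` determine the third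
    ((∀ φ ρ ψ : Functional d, φ = Phi ρ ψ ↔ φ.eta =
        NCSeries.inv (1 + ψ.M) * ρ.R.comp (fun i => (1 + ψ.M) * NCSeries.X i)) ∧
      (∀ ρ ρ' ψ : Functional d, Phi ρ ψ = Phi ρ' ψ → ρ = ρ') ∧
      (∀ ρ ψ ψ' : Functional d, (∀ a : Fin d → ℝ, ρ ≠ delta a) →
        Phi ρ ψ = Phi ρ ψ' → ψ = ψ')) ∧
    -- (b) positivity, mean and covariance
    ((∀ ρ ψ : Functional d, ρ.IsFreelyInfDiv → ψ.IsState → (Phi ρ ψ).IsState) ∧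
      (∀ ρ ψ : Functional d, (Phi ρ ψ).mean = ρ.mean ∧ (Phi ρ ψ).cov = ρ.cov)) ∧
    -- (c) fixed points
    ((∀ ρ ψ : Functional d, Phi ρ ψ = ψ ↔ ψ = ρ) ∧
      (∀ ρ σ : Functional d, Phi σ ρ = σ ↔ σ = ρ ∨ ∃ a : Fin d → ℝ, σ = delta a) ∧
      (∀ ψ : Functional d, PhiOne ψ = ψ ↔ ψ = freeProd fun _ => freeMeixner 0 0)) ∧
    -- (d) the image of `Φ[ρ, ·]`, in one variable and in several variables
    ((∀ ρ : Functional 1, ρ.IsFreelyInfDiv → ρ.mean = 0 → ρ.cov = 1 →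
        ({φ | ∃ ψ : Functional 1, ψ.IsState ∧ Phi ρ ψ = φ} =
            {φ : Functional 1 | φ.IsState ∧ φ.mean = ρ.mean ∧ φ.cov = ρ.cov} ↔
          ∃ b : ℝ, ρ = freeMeixner b 0)) ∧
      (∀ b : ℝ, (freeMeixner b 0).IsFreelyInfDiv ∧
        (freeMeixner b 0).mean = 0 ∧ (freeMeixner b 0).cov = 1) ∧
      (∀ ψ : Functional 1, Phi (freeMeixner 0 0) ψ = PhiOne ψ) ∧
      (∀ (b : ℝ) (ψ : Functional 1),
        Phi (freeMeixner b 0) ψ = PhiOne (boolConv ψ (delta fun _ => b))) ∧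
      (2 ≤ d → ∀ ρ : Functional d, ρ.IsFreelyInfDiv → ρ.mean = 0 → ρ.cov = 1 →
        {φ | ∃ ψ : Functional d, ψ.IsState ∧ Phi ρ ψ = φ} ≠
          {φ : Functional d | φ.IsState ∧ φ.mean = ρ.mean ∧ φ.cov = ρ.cov})) ∧
    -- (e) the image of `Φ[·, ψ]`
    ((∀ ψ : Functional d, ψ.IsState →
        ({φ | ∃ ρ : Functional d, ρ.IsFreelyInfDiv ∧ Phi ρ ψ = φ} =
            {φ : Functional d | φ.IsState} ↔
          ∃ a : Fin d → ℝ, ψ = delta a)) ∧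
      Function.Bijective (BP : Functional d → Functional d) ∧
      (∀ ρ : Functional d, Phi ρ (delta 0) = Function.invFun BP ρ) ∧
      (∀ (ρ : Functional d) (a : Fin d → ℝ),
        Phi ρ (delta a) = B a 0 (Function.invFun BP ρ)) ∧
      -- `Φ[ρ, δ_a]` is `B_{a,t}[ρ]` extended by continuity to `t = -1`
      (∀ (ρ : Functional d) (a : Fin d → ℝ) (p : NCPoly d),
        Filter.Tendsto (fun t : ℝ => B a t ρ p) (nhdsWithin (-1) {-1}ᶜ)
          (nhds (Phi ρ (delta a) p)))) := by
  refine ⟨⟨fun φ ρ ψ => ⟨?_, fun h => ext_eta (by rw [h, eta_Phi])⟩,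
      fun _ _ _ => Phi_injective_left, fun _ _ _ => Phi_injective_right⟩,
    ⟨fun _ _ hρ hψ => isState_Phi hρ.condPos hψ, fun ρ ψ => ⟨mean_Phi ρ ψ, cov_Phi ρ ψ⟩⟩,
    ⟨Phi_eq_right_iff, Phi_eq_left_iff, fun ψ => ?_⟩,
    ⟨fun _ => Phi_image_eq_iff,
      fun b => ⟨isFreelyInfDiv_freeMeixner b, mean_freeMeixner b, cov_freeMeixner b⟩,
      Phi_freeMeixner_zero, Phi_freeMeixner, fun hd _ _ => Phi_image_ne hd⟩,
    ⟨fun _ => Phi_onto_iff, BP_bijective, Phi_delta_zero, Phi_delta_eq_B, tendsto_B⟩⟩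
  · rintro rfl
    exact eta_Phi ρ ψ
  · rw [← Phi_freeProd_semicircular, Phi_eq_right_iff]
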